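/- Let $(K,*)$ be a field with involution. Let $\mathsf{LHomeo}$ be the class of pairs $(Y,\rho)$ where $Y$ is a totally disconnected compact metrizable space and $\rho\colon Y\to Y$ is a surjective local homeomorphism. The Deaconu–Renault groupoid $\mathcal G(Y,\rho)=\{(x,m-n,y)\mid x,y\in Y,\ m,n\ge 0,\ \rho^m(x)=\rho^n(y)\}$, with range $x$, source $y$, product $(x,k,y)(y,l,z)=(x,k+l,z)$ and inverse $(x,k,y)^{-1}=(y,-k,x)$, carries the topology generated by the sets $Z(U,m,n,V)=\{(x,m-n,y)\mid x\in U,\ y\in V,\ \rho^m(x)=\rho^n(y)\}$ with $U,V\subseteq Y$ open and $m,n\ge 0$. Its Steinberg algebra $A_K(\mathcal G)$ is the unital $*$-algebra of all locally constant functions $\mathcal G\to K$ with compact support, with product $(f*g)(\gamma)=\sum_{s(\alpha)=s(\gamma)}f(\gamma\alpha^{-1})g(\alpha)$ and involution $f^*(\gamma)=f(\gamma^{-1})^*$. A generalized finite shift graph $(E,C)$ consists of finite vertex sets $E^{0,0},E^{0,1}$, finite sets $B$ (blue) and $R$ (red) of edges from $E^{0,1}$ to $E^{0,0}$, such that for every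 $v\in E^{0,0}$ the sets $B_v,R_v$ of blue and of red edges with range $v$ are nonempty, and every vertex of $E^{0,1}$ is the source of exactly one blue edge and at least one red edge; the separation is $C_v=\{B_v,R_v\}$. The one-step resolution $(E_1,C^1)$ of a finite bipartite separated graph has $E_1^{0,0}=E^{0,1}$; a vertex of $E_1^{0,1}$ is a vertex $u\in E^{0,0}$ with a choice of an edge $x_c\in c$ for each $c\in C_u$; for each such vertex $w$ and each $c\in C_u$ there is one edge $\alpha$, with source $w$ and range $s(x_c)$; and $\alpha$ belongs to the set $X(x_c)$, where the sets $X(x)$, $s(x)=v$, form the separation at $v$. Let $(E_n,C^n)$, $n\ge 0$, be the iterated resolutions of a generalized finite shift graph $(E,C)=(E_0,C^0)$; an edge of $E_{n+1}$ is blue if it belongs to $X(x)$ for a blue edge $x$ of $E_n$, and red otherwise. A romb $(e_0,e_1,f_0,f_1)$ consists of blue edges $e_0,e_1$ and red edges $f_0,f_1$, with $e_0,f_0\in E_n^1$ and $e_1,f_1\in E_{n+1}^1$ for some $n$, such that $r(e_1)=s(e_0)$, $r(f_1)=s(f_0)$, $r(e_0)=r(f_0)$ and $s(e_1)=s(f_1)$.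 The generalized finite shift $(X,\sigma)$ associated to $(E,C)$ is the space $X$ of sequences $(e_0,e_1,\dots)$ of blue edges $e_n\in E_n^1$ with $r(e_{n+1})=s(e_n)$ (topology of cylinder sets), with $\sigma(e_0,e_1,\dots)=(e_0',e_1',\dots)$ the unique element of $X$ for which there are edges $f_n\in E^1_n$ such that, for all $j\ge 0$, $(e_{2j},e_{2j+1},f_{2j},f_{2j+1})$ is a romb with $f_{2j+1}\in X(f_{2j})$, and $(e'_{2j+1},e'_{2j+2},f_{2j+1},f_{2j+2})$ is a romb. An $(E,C)$-structure on $(Y,\rho)\in\mathsf{LHomeo}$ consists of nonempty compact open sets $Z_e$ ($e\in B$) and $W_f$ ($f\in R$) of $Y$ such that $Y=\bigsqcup_{e\in B}Z_e$, $\bigsqcup_{e\in B_v}Z_e=\bigsqcup_{f\in R_v}W_f$ for all $v\in E^{0,0}$, and $\rho$ maps $W_f$ injectively onto $Z_e$ whenever $s(e)=s(f)$. A map $\psi$ between systems with $(E,C)$-structures is $(E,C)$-equivariant if it intertwines the two local homeomorphisms and maps each set $Z_e$, $W_f$ of the first structure into the corresponding set of the second. **Theorem.** Let $(E,C)$ be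 a generalized finite shift graph with generalized finite shift $(X,\sigma)$, and let $(Y,\rho)\in\mathsf{LHomeo}$ carry an $(E,C)$-structure. Then $(X,\sigma)\in\mathsf{LHomeo}$, the sets $H_e=\{x\in X\mid x_0=e\}$ ($e\in B$) and $H_f=\{x\in X\mid \text{there is a romb }(x_0,x_1,f,f_1)\text{ with } f_1\in X(f)\}$ ($f\in R$) form an $(E,C)$-structure on $(X,\sigma)$, and there is a unique continuous $(E,C)$-equivariant map $\psi\colon Y\to X$. The induced map $$\psi_*\colon\mathcal G(Y,\rho)\to\mathcal G(X,\sigma),\qquad \psi_*(x,k,y)=(\psi(x),k,\psi(y)),$$ is a continuous groupoid homomorphism, is proper (preimages of compact sets are compact), and for every $y\in Y$ it restricts to a bijection from the elements with source $y$ onto the elements with source $\psi(y)$. Moreover $\psi^*(f)=f\circ\psi_*$ defines a (unital) $K$-algebra $*$-homomorphism $\psi^*\colon A_K(\mathcal G(X,\sigma))\to A_K(\mathcal G(Y,\rho))$. -/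

import Mathlib

universe u v w

/-- `(X, σ)` is a surjective local homeomorphism of a totally disconnected compact metrizable
space. -/
structure IsLHomeo {X : Type*} [TopologicalSpace X] (σ : X → X) : Prop where
  compactSpace : CompactSpace X
  metrizableSpace : TopologicalSpace.MetrizableSpace X
  totallyDisconnectedSpace : TotallyDisconnectedSpace X
  surjective : Function.Surjective σ
  isLocalHomeomorph : IsLocalHomeomorph σ

/-- The Deaconu-Renault groupoid of `σ`, as a set of triples `(x, m - n, y)` with
`σ^m x = σ^n y`. -/
def DR {X : Type*} (σ : X → X) : Type _ :=
  {p : X × ℤ × X // ∃ m n : ℕ, p.2.1 = (m : ℤ) - n ∧ σ^[m] p.1 = σ^[n] p.2.2}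

namespace DR

variable {X : Type*} {σ : X → X}

/-- Range of `(x, k, y)`. -/
def rng (γ : DR σ) : X := γ.1.1

/-- The middle coordinate of `(x, k, y)`. -/
def deg (γ : DR σ) : ℤ := γ.1.2.1

/-- Source of `(x, k, y)`. -/
def src (γ : DR σ) : X := γ.1.2.2

theorem ext {γ δ : DR σ} (h1 : γ.rng = δ.rng) (h2 : γ.deg = δ.deg) (h3 : γ.src = δ.src) :
    γ = δ :=
  Subtype.ext (Prod.ext h1 (Prod.ext h2 h3))

/-- The product `(x, k, y)(y, l, z) = (x, k + l, z)`. -/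
def mul (γ δ : DR σ) (h : γ.src = δ.rng) : DR σ :=
  ⟨(γ.rng, γ.deg + δ.deg, δ.src), by
    obtain ⟨⟨x, k, y⟩, m, n, hk, hxy⟩ := γ
    obtain ⟨⟨y', l, z⟩, p, q, hl, hyz⟩ := δ
    dsimp only [src, rng, deg] at *
    subst h
    refine ⟨p + m, n + q, by push_cast; linarith, ?_⟩
    rw [Function.iterate_add_apply, hxy, ← Function.iterate_add_apply, add_comm p n,
      Function.iterate_add_apply, hyz, ← Function.iterate_add_apply]⟩

/-- The inverse `(x, k, y)⁻¹ = (y, -k, x)`. -/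
def inv (γ : DR σ) : DR σ :=
  ⟨(γ.src, -γ.deg, γ.rng), by
    obtain ⟨m, n, hk, h⟩ := γ.2
    exact ⟨n, m, by dsimp only [deg]; omega, h.symm⟩⟩

/-- The unit `(x, 0, x)`. -/
def unit (σ : X → X) (x : X) : DR σ := ⟨(x, 0, x), 0, 0, by simp, rfl⟩

/-- `γ α⁻¹`, for two elements with the same source. -/
def div (γ α : DR σ) (h : α.src = γ.src) : DR σ := γ.mul α.inv h.symm

@[simp] theorem rng_mul (γ δ : DR σ) (h) : (γ.mul δ h).rng = γ.rng := rfl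
@[simp] theorem deg_mul (γ δ : DR σ) (h) : (γ.mul δ h).deg = γ.deg + δ.deg := rfl
@[simp] theorem src_mul (γ δ : DR σ) (h) : (γ.mul δ h).src = δ.src := rfl
@[simp] theorem rng_inv (γ : DR σ) : γ.inv.rng = γ.src := rfl
@[simp] theorem deg_inv (γ : DR σ) : γ.inv.deg = -γ.deg := rfl
@[simp] theorem src_inv (γ : DR σ) : γ.inv.src = γ.rng := rfl
@[simp] theorem rng_div (γ δ : DR σ) (h) : (γ.div δ h).rng = γ.rng := rfl
@[simp] theorem deg_div (γ δ : DR σ) (h) : (γ.div δ h).deg = γ.deg - δ.deg := rfl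
@[simp] theorem src_div (γ δ : DR σ) (h) : (γ.div δ h).src = δ.rng := rfl
@[simp] theorem rng_unit (x : X) : (unit σ x).rng = x := rfl
@[simp] theorem deg_unit (x : X) : (unit σ x).deg = 0 := rfl
@[simp] theorem src_unit (x : X) : (unit σ x).src = x := rfl
@[simp] theorem inv_inv (γ : DR σ) : γ.inv.inv = γ := ext rfl (by simp) rfl

/-- The map `ψ_* (x, k, y) = (ψ x, k, ψ y)` induced by a map `ψ` with `ψ ∘ ρ = σ ∘ ψ`. -/
def map {Y : Type*} {ρ : Y → Y} (ψ : Y → X) (h : Function.Semiconj ψ ρ σ) (γ : DR ρ) : DR σ :=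
  ⟨(ψ γ.rng, γ.deg, ψ γ.src), by
    obtain ⟨m, n, hk, hm⟩ := γ.2
    refine ⟨m, n, hk, ?_⟩
    have h1 := (h.iterate_right m) γ.rng
    have h2 := (h.iterate_right n) γ.src
    exact h1.symm.trans ((congrArg ψ hm).trans h2)⟩

/-- The cylinder set `Z(U, m, n, V)`. -/
def cyl (σ : X → X) (U : Set X) (m n : ℕ) (V : Set X) : Set (DR σ) :=
  {γ | γ.rng ∈ U ∧ γ.src ∈ V ∧ γ.deg = (m : ℤ) - n ∧ σ^[m] γ.rng = σ^[n] γ.src}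

theorem cyl_le {U V : Set X} {m n : ℕ} (t : ℕ) : cyl σ U m n V ⊆ cyl σ U (t + m) (t + n) V := by
  rintro γ ⟨h1, h2, h3, h4⟩
  refine ⟨h1, h2, by push_cast; omega, ?_⟩
  rw [Function.iterate_add_apply, h4, ← Function.iterate_add_apply]

theorem exists_cyl (γ : DR σ) : ∃ m n : ℕ, γ ∈ cyl σ Set.univ m n Set.univ := by
  obtain ⟨m, n, h⟩ := γ.2
  exact ⟨m, n, trivial, trivial, h⟩

variable [TopologicalSpace X]

/-- The topology generated by the cylinder sets with `U`, `V` open. -/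
instance : TopologicalSpace (DR σ) :=
  TopologicalSpace.generateFrom
    {S | ∃ (U V : Set X) (m n : ℕ), IsOpen U ∧ IsOpen V ∧ S = cyl σ U m n V}

theorem isOpen_cyl {U V : Set X} (m n : ℕ) (hU : IsOpen U) (hV : IsOpen V) :
    IsOpen (cyl σ U m n V) :=
  TopologicalSpace.isOpen_generateFrom_of_mem ⟨U, V, m, n, hU, hV, rfl⟩

theorem continuous_src : Continuous (src : DR σ → X) := by
  refine ⟨fun V hV => ?_⟩
  have : src ⁻¹' V = ⋃ m, ⋃ n, cyl σ Set.univ m n V := by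
    ext γ
    obtain ⟨m, n, _, _, h⟩ := exists_cyl γ
    simp only [Set.mem_preimage, Set.mem_iUnion]
    exact ⟨fun hv => ⟨m, n, trivial, hv, h⟩, fun ⟨_, _, h⟩ => h.2.1⟩
  rw [this]
  exact isOpen_iUnion fun m => isOpen_iUnion fun n => isOpen_cyl m n isOpen_univ hV

theorem continuous_inv : Continuous (inv : DR σ → DR σ) := by
  refine continuous_generateFrom_iff.2 ?_
  rintro _ ⟨U, V, m, n, hU, hV, rfl⟩
  have : inv ⁻¹' (cyl σ U m n V) = cyl σ V n m U := by
    ext γ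
    simp only [cyl, Set.mem_preimage, Set.mem_ofPred_eq, rng_inv, src_inv, deg_inv]
    constructor
    · rintro ⟨h1, h2, h3, h4⟩
      exact ⟨h2, h1, by omega, h4.symm⟩
    · rintro ⟨h1, h2, h3, h4⟩
      exact ⟨h2, h1, by omega, h4.symm⟩
  rw [this]
  exact isOpen_cyl n m hV hU

theorem continuous_rng : Continuous (rng : DR σ → X) :=
  (continuous_src (σ := σ)).comp continuous_inv

theorem continuous_deg : Continuous (deg : DR σ → ℤ) := by
  refine continuous_discrete_rng.2 fun k => ?_
  have : deg ⁻¹' {k} = ⋃ m : ℕ, ⋃ n : ℕ, ⋃ _ : k = (m : ℤ) - n,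
      cyl σ Set.univ m n Set.univ := by
    ext γ
    obtain ⟨m, n, _, _, h⟩ := exists_cyl γ
    simp only [Set.mem_preimage, Set.mem_iUnion, Set.mem_singleton_iff]
    exact ⟨fun hv => ⟨m, n, hv ▸ h.1, trivial, trivial, h⟩,
      fun ⟨_, _, hk, h⟩ => h.2.2.1.trans hk.symm⟩
  rw [this]
  exact isOpen_iUnion fun m => isOpen_iUnion fun n => isOpen_iUnion fun _ =>
    isOpen_cyl m n isOpen_univ isOpen_univ

theorem t2Space [T2Space X] : T2Space (DR σ) := by
  refine T2Space.of_injective_continuous (f := fun γ : DR σ => (γ.rng, γ.deg, γ.src)) ?_ ?_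
  · intro γ δ h
    simp only [Prod.mk.injEq] at h
    exact ext h.1 h.2.1 h.2.2
  · exact continuous_rng.prodMk (continuous_deg.prodMk continuous_src)

theorem isTopologicalBasis : TopologicalSpace.IsTopologicalBasis
    {S : Set (DR σ) | ∃ (U V : Set X) (m n : ℕ), IsOpen U ∧ IsOpen V ∧ S = cyl σ U m n V} := by
  refine ⟨?_, ?_, rfl⟩
  · rintro _ ⟨U, V, m, n, hU, hV, rfl⟩ _ ⟨U', V', m', n', hU', hV', rfl⟩ γ ⟨h, h'⟩
    obtain ⟨h1, h2, h3, h4⟩ := h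
    obtain ⟨h1', h2', h3', h4'⟩ := h'
    rcases le_total m m' with hm | hm
    · obtain ⟨t, rfl⟩ := Nat.exists_eq_add_of_le' hm
      obtain rfl : n' = t + n := by omega
      exact ⟨_, ⟨U ∩ U', V ∩ V', m, n, hU.inter hU', hV.inter hV', rfl⟩,
        ⟨⟨h1, h1'⟩, ⟨h2, h2'⟩, h3, h4⟩, fun δ hδ => ⟨⟨hδ.1.1, hδ.2.1.1, hδ.2.2⟩,
          cyl_le t ⟨hδ.1.2, hδ.2.1.2, hδ.2.2⟩⟩⟩
    · obtain ⟨t, rfl⟩ := Nat.exists_eq_add_of_le' hm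
      obtain rfl : n = t + n' := by omega
      exact ⟨_, ⟨U ∩ U', V ∩ V', m', n', hU.inter hU', hV.inter hV', rfl⟩,
        ⟨⟨h1, h1'⟩, ⟨h2, h2'⟩, h3', h4'⟩, fun δ hδ =>
          ⟨cyl_le t ⟨hδ.1.1, hδ.2.1.1, hδ.2.2⟩, ⟨hδ.1.2, hδ.2.1.2, hδ.2.2⟩⟩⟩
  · refine Set.eq_univ_of_forall fun γ => ?_
    obtain ⟨m, n, h⟩ := exists_cyl γ
    exact ⟨_, ⟨Set.univ, Set.univ, m, n, isOpen_univ, isOpen_univ, rfl⟩, h⟩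

theorem iterate_isLocalHomeomorph (hσ : IsLocalHomeomorph σ) (m : ℕ) :
    IsLocalHomeomorph (σ^[m]) := by
  induction m with
  | zero => exact (Homeomorph.refl X).isLocalHomeomorph
  | succ m ih => exact ih.comp hσ

theorem exists_injOn (hσ : IsLocalHomeomorph σ) (m : ℕ) (x : X) :
    ∃ U, IsOpen U ∧ x ∈ U ∧ Set.InjOn (σ^[m]) U := by
  obtain ⟨e, he, h⟩ := iterate_isLocalHomeomorph hσ m x
  exact ⟨e.source, e.open_source, he, h ▸ e.injOn⟩

/-- For fixed `m`, `n` with `γ ∈ Z(X, m, n, X)`, the sets `Z(U, m, n, V)` form a neighborhood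
basis at `γ`. -/
theorem exists_cyl_subset (hσ : IsLocalHomeomorph σ) {γ : DR σ} {m n : ℕ}
    (hγ : γ ∈ cyl σ Set.univ m n Set.univ) {S : Set (DR σ)} (hS : IsOpen S) (hγS : γ ∈ S) :
    ∃ U V, IsOpen U ∧ IsOpen V ∧ γ.rng ∈ U ∧ γ.src ∈ V ∧ cyl σ U m n V ⊆ S := by
  obtain ⟨_, ⟨U, V, p, q, hU, hV, rfl⟩, ⟨h1, h2, h3, h4⟩, hsub⟩ :=
    isTopologicalBasis.exists_subset_of_mem_open hγS hS
  obtain ⟨-, -, h3', h4'⟩ := hγ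
  rcases le_total m p with hm | hm
  · obtain ⟨t, rfl⟩ := Nat.exists_eq_add_of_le' hm
    obtain rfl : q = t + n := by omega
    exact ⟨U, V, hU, hV, h1, h2, (cyl_le t).trans hsub⟩
  · obtain ⟨t, rfl⟩ := Nat.exists_eq_add_of_le' hm
    obtain rfl : n = t + q := by omega
    obtain ⟨O, hO, hxO, hinj⟩ := exists_injOn hσ t (σ^[p] γ.rng)
    have hc := fun k => (iterate_isLocalHomeomorph hσ k).continuous
    refine ⟨U ∩ σ^[p] ⁻¹' O, V ∩ σ^[q] ⁻¹' O, hU.inter (hO.preimage (hc p)),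
      hV.inter (hO.preimage (hc q)), ⟨h1, hxO⟩, ⟨h2, by rw [Set.mem_preimage, ← h4]; exact hxO⟩, ?_⟩
    rintro δ ⟨⟨a1, a2⟩, ⟨b1, b2⟩, c, d⟩
    refine hsub ⟨a1, b1, by push_cast at c; omega, hinj a2 b2 ?_⟩
    rwa [← Function.iterate_add_apply, ← Function.iterate_add_apply]

theorem exists_nhd_injOn_src (hσ : IsLocalHomeomorph σ) (γ : DR σ) :
    ∃ S : Set (DR σ), IsOpen S ∧ γ ∈ S ∧ Set.InjOn src S := by
  obtain ⟨m, n, h⟩ := exists_cyl γ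
  obtain ⟨U, hU, hx, hinj⟩ := exists_injOn hσ m γ.rng
  refine ⟨cyl σ U m n Set.univ, isOpen_cyl m n hU isOpen_univ, ⟨hx, h.2⟩, ?_⟩
  rintro a ⟨a1, -, a3, a4⟩ b ⟨b1, -, b3, b4⟩ hab
  exact ext (hinj a1 b1 (by rw [a4, b4, hab])) (a3.trans b3.symm) hab

theorem isOpenMap_src (hσ : IsLocalHomeomorph σ) : IsOpenMap (src : DR σ → X) := by
  refine isTopologicalBasis.isOpenMap_iff.2 ?_
  rintro _ ⟨U, V, m, n, hU, hV, rfl⟩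
  have : src '' cyl σ U m n V = V ∩ σ^[n] ⁻¹' (σ^[m] '' U) := by
    ext y
    constructor
    · rintro ⟨γ, ⟨h1, h2, -, h4⟩, rfl⟩
      exact ⟨h2, γ.rng, h1, h4⟩
    · rintro ⟨hy, x, hx, hxy⟩
      exact ⟨⟨(x, (m : ℤ) - n, y), m, n, rfl, hxy⟩, ⟨hx, hy, rfl, hxy⟩, rfl⟩
  rw [this]
  exact hV.inter (((iterate_isLocalHomeomorph hσ m).isOpenMap U hU).preimage
    (iterate_isLocalHomeomorph hσ n).continuous)

theorem exists_nhds_div (hσ : IsLocalHomeomorph σ) {γ α : DR σ} (h : α.src = γ.src)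
    {S : Set (DR σ)} (hS : IsOpen S) (hmem : γ.div α h ∈ S) :
    ∃ A B : Set (DR σ), IsOpen A ∧ IsOpen B ∧ γ ∈ A ∧ α ∈ B ∧
      ∀ γ' ∈ A, ∀ α' ∈ B, ∀ h' : α'.src = γ'.src, γ'.div α' h' ∈ S := by
  obtain ⟨a, b, -, -, h1, h2⟩ := exists_cyl γ
  obtain ⟨p, q, -, -, h3, h4⟩ := exists_cyl α
  have key : ∀ γ' α' : DR σ, σ^[a] γ'.rng = σ^[b] γ'.src → σ^[p] α'.rng = σ^[q] α'.src →
      α'.src = γ'.src → σ^[q + a] γ'.rng = σ^[b + p] α'.rng := by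
    intro γ' α' e1 e2 e3
    rw [Function.iterate_add_apply, e1, Function.iterate_add_apply, e2, e3,
      ← Function.iterate_add_apply, ← Function.iterate_add_apply, add_comm]
  obtain ⟨U, V, hU, hV, hx, hz, hsub⟩ := exists_cyl_subset hσ (m := q + a) (n := b + p)
    (γ := γ.div α h)
    ⟨trivial, trivial, by rw [deg_div]; push_cast; omega, key γ α h2 h4 h⟩ hS hmem
  refine ⟨cyl σ U a b Set.univ, cyl σ V p q Set.univ, isOpen_cyl _ _ hU isOpen_univ,
    isOpen_cyl _ _ hV isOpen_univ, ⟨hx, trivial, h1, h2⟩, ⟨hz, trivial, h3, h4⟩, ?_⟩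
  rintro γ' ⟨a1, -, a3, a4⟩ α' ⟨b1, -, b3, b4⟩ h'
  exact hsub ⟨a1, b1, by rw [deg_div]; push_cast; omega, key γ' α' a4 b4 h'⟩

end DR

/-- The underlying space of the Steinberg algebra `A_K(𝒢(X, σ))`: all locally constant functions
with compact support. (The support of a locally constant function is closed.) -/
def steinbergSubmodule (K : Type*) [Field K] {X : Type*} [TopologicalSpace X] (σ : X → X) :
    Submodule K (DR σ → K) where
  carrier := {f | IsLocallyConstant f ∧ HasCompactSupport f}
  add_mem' hf hg := ⟨hf.1.add hg.1, hf.2.add hg.2⟩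
  zero_mem' := ⟨IsLocallyConstant.const 0, HasCompactSupport.zero⟩
  smul_mem' c _ hf := ⟨hf.1.comp (fun x => c * x), hf.2.comp_left (g := fun x => c * x) (mul_zero c)⟩

/-- The convolution product
`(f * g)(γ) = ∑ f(γ α⁻¹) g(α)`, summed over all `α` with `s(α) = s(γ)`. -/
noncomputable def DR.conv {K : Type*} [Field K] {X : Type*} {σ : X → X} (f g : DR σ → K)
    (γ : DR σ) : K :=
  ∑ᶠ α : {α : DR σ // α.src = γ.src}, f (γ.div α.1 α.2) * g α.1

/-- The indicator function of the unit space. -/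
noncomputable def DR.one (K : Type*) [Field K] {X : Type*} (σ : X → X) : DR σ → K :=
  Set.indicator (Set.range (DR.unit σ)) 1

namespace DR

variable {K : Type*} [Field K] {X : Type*} {σ : X → X}

theorem mem_range_unit {γ : DR σ} :
    γ ∈ Set.range (unit σ) ↔ γ.rng = γ.src ∧ γ.deg = 0 := by
  constructor
  · rintro ⟨x, rfl⟩
    exact ⟨rfl, rfl⟩
  · rintro ⟨h1, h2⟩
    exact ⟨γ.src, ext h1.symm h2.symm rfl⟩

theorem conv_one (f : DR σ → K) : conv f (one K σ) = f := by
  funext γ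
  rw [conv, finsum_eq_single _ (⟨unit σ γ.src, rfl⟩ : {α : DR σ // α.src = γ.src})]
  · have h1 : one K σ (unit σ γ.src) = 1 := Set.indicator_of_mem (Set.mem_range_self _) _
    have h2 : γ.div (unit σ γ.src) rfl = γ := ext rfl (show γ.deg + -0 = γ.deg by ring) rfl
    rw [h1, h2, mul_one]
  · rintro ⟨α, hα⟩ hne
    have : one K σ α = 0 := Set.indicator_of_notMem (fun hr => hne (by
      obtain ⟨x, rfl⟩ := hr
      have hα : x = γ.src := hα
      subst hα
      rfl)) _
    rw [this, mul_zero]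

theorem one_conv (f : DR σ → K) : conv (one K σ) f = f := by
  funext γ
  rw [conv, finsum_eq_single _ (⟨γ, rfl⟩ : {α : DR σ // α.src = γ.src})]
  · have h1 : one K σ (γ.div γ rfl) = 1 :=
      Set.indicator_of_mem (mem_range_unit.2 (And.intro rfl (add_neg_cancel _))) _
    rw [h1, one_mul]
  · rintro ⟨α, hα⟩ hne
    have : one K σ (γ.div α hα) = 0 := Set.indicator_of_notMem (fun h => hne (by
      obtain ⟨h1, h2⟩ := mem_range_unit.1 h
      exact Subtype.ext (ext h1.symm (by rw [deg_div] at h2; dsimp only; omega) hα))) _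
    rw [this, zero_mul]

theorem zero_conv (f : DR σ → K) : conv 0 f = 0 := by
  funext γ
  simp [conv]

theorem conv_zero (f : DR σ → K) : conv f 0 = 0 := by
  funext γ
  simp [conv]

theorem smul_conv (c : K) (f g : DR σ → K) : conv (c • f) g = c • conv f g := by
  funext γ
  simp only [conv, Pi.smul_apply, smul_eq_mul, mul_assoc]
  rw [mul_finsum]

theorem conv_smul (c : K) (f g : DR σ → K) : conv f (c • g) = c • conv f g := by
  funext γ
  simp only [conv, Pi.smul_apply, smul_eq_mul, mul_left_comm _ c]
  rw [mul_finsum]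

/-- Right translation by `α⁻¹` identifies the source fibre of `γ` with that of `γ α⁻¹`. -/
def fiberEquiv (γ α : DR σ) (h : α.src = γ.src) :
    {δ : DR σ // δ.src = γ.src} ≃ {β : DR σ // β.src = (γ.div α h).src} where
  toFun δ := ⟨δ.1.div α (h.trans δ.2.symm), rfl⟩
  invFun β := ⟨β.1.mul α β.2, h⟩
  left_inv δ := Subtype.ext (ext rfl
    (show δ.1.deg + -α.deg + α.deg = δ.1.deg by ring) (h.trans δ.2.symm))
  right_inv β := Subtype.ext (ext rfl
    (show β.1.deg + α.deg + -α.deg = β.1.deg by ring) β.2.symm)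

theorem conv_eq (f g : DR σ → K) (γ : DR σ) {y : X} (hy : γ.src = y) :
    conv f g γ =
      ∑ᶠ α : {α : DR σ // α.src = y}, f (γ.div α.1 (α.2.trans hy.symm)) * g α.1 := by
  subst hy
  rfl

/-- The substitution `β = α γ⁻¹`. -/
def starEquiv (γ : DR σ) :
    {α : DR σ // α.src = γ.src} ≃ {β : DR σ // β.src = γ.inv.src} where
  toFun α := ⟨α.1.div γ α.2.symm, rfl⟩
  invFun β := ⟨β.1.mul γ β.2, rfl⟩
  left_inv α := Subtype.ext (ext rfl
    (show α.1.deg + -γ.deg + γ.deg = α.1.deg by ring) α.2.symm)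
  right_inv β := Subtype.ext (ext rfl
    (show β.1.deg + γ.deg + -γ.deg = β.1.deg by ring) β.2.symm)

variable [TopologicalSpace X]

theorem isCompact_support {f : DR σ → K} (hf : f ∈ steinbergSubmodule K σ) :
    IsCompact (Function.support f) := by
  have h : IsClosed (Function.support f) := (hf.1.isOpen_fiber 0).isClosed_compl
  have := hf.2
  rwa [HasCompactSupport, tsupport, h.closure_eq] at this

theorem finite_fiber (hσ : IsLHomeo σ) {S : Set (DR σ)} (hS : IsCompact S) (y : X) :
    (S ∩ {α | α.src = y}).Finite := by
  have := hσ.metrizableSpace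
  have hc : IsCompact (S ∩ {α | α.src = y}) :=
    hS.inter_right (isClosed_singleton.preimage continuous_src)
  choose V hV hm hinj using fun γ : DR σ => exists_nhd_injOn_src hσ.isLocalHomeomorph γ
  obtain ⟨t, ht, hsub⟩ := hc.elim_nhds_subcover V fun γ _ => (hV γ).mem_nhds (hm γ)
  refine t.finite_toSet.subset fun α hα => ?_
  obtain ⟨β, hβ, hαβ⟩ := Set.mem_iUnion₂.1 (hsub hα)
  have : α = β := hinj β hαβ (hm β) (hα.2.trans (ht β hβ).2.symm)
  exact this ▸ hβ

theorem finite_conv (hσ : IsLHomeo σ) (f : DR σ → K) {g : DR σ → K}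
    (hg : g ∈ steinbergSubmodule K σ) (γ : DR σ) :
    (Function.support fun α : {α : DR σ // α.src = γ.src} =>
      f (γ.div α.1 α.2) * g α.1).Finite := by
  refine Set.Finite.subset (((finite_fiber hσ (isCompact_support hg) γ.src)).preimage
    Subtype.val_injective.injOn) fun α hα => ?_
  exact ⟨right_ne_zero_of_mul hα, α.2⟩

theorem isLocallyConstant_conv (hσ : IsLHomeo σ) {f g : DR σ → K}
    (hf : f ∈ steinbergSubmodule K σ) (hg : g ∈ steinbergSubmodule K σ) :
    IsLocallyConstant (conv f g) := by
  have := hσ.metrizableSpace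
  have := t2Space (σ := σ)
  have hl := hσ.isLocalHomeomorph
  refine (IsLocallyConstant.iff_exists_open _).2 fun γ₀ => ?_
  have hfin := finite_fiber hσ (isCompact_support hg) γ₀.src
  set T := Function.support g ∩ {α | α.src = γ₀.src} with hT
  obtain ⟨D, hD, hdisj⟩ := hfin.t2_separation
  have hex : ∀ α : T, ∃ A V : Set (DR σ), IsOpen A ∧ IsOpen V ∧ γ₀ ∈ A ∧ α.1 ∈ V ∧ V ⊆ D α.1 ∧
      Set.InjOn src V ∧ (∀ β ∈ V, g β = g α.1) ∧
      ∀ γ ∈ A, ∀ β ∈ V, ∀ h : β.src = γ.src, f (γ.div β h) = f (γ₀.div α.1 α.2.2) := by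
    intro α
    obtain ⟨A, B, hA, hB, ha, hb, hAB⟩ := exists_nhds_div hl α.2.2
      (hf.1.isOpen_fiber (f (γ₀.div α.1 α.2.2))) rfl
    obtain ⟨W, hW, hαW, hinj⟩ := exists_nhd_injOn_src hl α.1
    refine ⟨A, B ∩ D α.1 ∩ W ∩ {β | g β = g α.1}, hA,
      ((hB.inter (hD α.1).2).inter hW).inter (hg.1.isOpen_fiber _), ha,
      ⟨⟨⟨hb, (hD α.1).1⟩, hαW⟩, rfl⟩, fun β hβ => hβ.1.1.2, hinj.mono fun β hβ => hβ.1.2,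
      fun β hβ => hβ.2, fun γ hγ β hβ h => hAB γ hγ β hβ.1.1.1 h⟩
  choose A V hA hV hγA hαV hVD hinj hgV hfV using hex
  have : Finite T := hfin
  have : Fintype T := Fintype.ofFinite T
  have hC : IsCompact (Function.support g \ ⋃ α, V α) :=
    (isCompact_support hg).diff (isOpen_iUnion hV)
  refine ⟨(⋂ α : T, A α ∩ src ⁻¹' (src '' V α)) ∩
    src ⁻¹' (src '' (Function.support g \ ⋃ α, V α))ᶜ, ?_, ?_, ?_⟩
  · exact (isOpen_iInter_of_finite fun α =>
      (hA α).inter ((isOpenMap_src hl _ (hV α)).preimage continuous_src)).inter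
      ((hC.image continuous_src).isClosed.isOpen_compl.preimage continuous_src)
  · refine ⟨Set.mem_iInter.2 fun α => ⟨hγA α, α.1, hαV α, α.2.2⟩, ?_⟩
    rintro ⟨β, hβ, hs⟩
    exact hβ.2 (Set.mem_iUnion.2 ⟨⟨β, hβ.1, hs⟩, hαV _⟩)
  · have main : ∀ γ ∈ (⋂ α : T, A α ∩ src ⁻¹' (src '' V α)) ∩
        src ⁻¹' (src '' (Function.support g \ ⋃ α, V α))ᶜ,
        conv f g γ = ∑ α : T, f (γ₀.div α.1 α.2.2) * g α.1 := by
      rintro γ ⟨h1, h2⟩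
      have h3 := fun α => (Set.mem_iInter.1 h1 α)
      choose h4 β hβV hβ using h3
      let i : T → {α : DR σ // α.src = γ.src} := fun α => ⟨β α, hβ α⟩
      have hi : Function.Injective i := by
        intro α α' h
        have h : β α = β α' := congrArg Subtype.val h
        by_contra hne
        exact Set.disjoint_left.1 (hdisj α.2 α'.2 (fun h => hne (Subtype.ext h)))
          (hVD α (hβV α)) (hVD α' (h ▸ hβV α'))
      have hsupp : (Function.support fun α : {α : DR σ // α.src = γ.src} =>
          f (γ.div α.1 α.2) * g α.1) ⊆ Set.range i := by
        rintro ⟨δ, hδ⟩ h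
        have hg0 : g δ ≠ 0 := right_ne_zero_of_mul h
        have : δ ∈ ⋃ α, V α := by
          by_contra hn
          exact h2 ⟨δ, ⟨hg0, hn⟩, hδ⟩
        obtain ⟨α, hα⟩ := Set.mem_iUnion.1 this
        exact ⟨α, Subtype.ext (hinj α (hβV α) hα ((hβ α).trans hδ.symm))⟩
      have : conv f g γ = ∑ᶠ α : T, f (γ.div (β α) (hβ α)) * g (β α) := by
        rw [conv, ← finsum_mem_univ, finsum_mem_inter_support_eq' _ Set.univ (Set.range i)
          fun x hx => ⟨fun _ => hsupp hx, fun _ => trivial⟩, finsum_mem_range hi]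
      rw [this, finsum_eq_sum_of_fintype]
      exact Finset.sum_congr rfl fun α _ => by
        rw [hgV α _ (hβV α), hfV α γ (h4 α) _ (hβV α) (hβ α)]
    intro γ hγ
    rw [main γ hγ, main γ₀]
    refine ⟨Set.mem_iInter.2 fun α => ⟨hγA α, α.1, hαV α, α.2.2⟩, ?_⟩
    rintro ⟨β, hβ, hs⟩
    exact hβ.2 (Set.mem_iUnion.2 ⟨⟨β, hβ.1, hs⟩, hαV _⟩)

theorem hasCompactSupport_conv (hσ : IsLHomeo σ) {f g : DR σ → K}
    (hf : f ∈ steinbergSubmodule K σ) (hg : g ∈ steinbergSubmodule K σ) :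
    HasCompactSupport (conv f g) := by
  classical
  have := hσ.metrizableSpace
  have := t2Space (σ := σ)
  have hl := hσ.isLocalHomeomorph
  let P : Set (DR σ × DR σ) := {p | p.2.src = p.1.src}
  let D : DR σ × DR σ → DR σ := fun p => if h : p.2.src = p.1.src then p.1.div p.2 h else p.1
  have hD : ContinuousOn D P := by
    rintro ⟨γ, α⟩ h
    have h : α.src = γ.src := h
    rw [ContinuousWithinAt, show D (γ, α) = γ.div α h from dif_pos h, tendsto_nhds]
    intro S hS hm
    obtain ⟨A, B, hA, hB, ha, hb, hAB⟩ := exists_nhds_div hl h hS hm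
    filter_upwards [self_mem_nhdsWithin, mem_nhdsWithin_of_mem_nhds
      ((hA.prod hB).mem_nhds ⟨ha, hb⟩)] with p hp hp'
    have hp : p.2.src = p.1.src := hp
    rw [Set.mem_preimage, show D p = p.1.div p.2 hp from dif_pos hp]
    exact hAB _ hp'.1 _ hp'.2 hp
  have hP : IsClosed P :=
    isClosed_eq (continuous_src.comp continuous_snd) (continuous_src.comp continuous_fst)
  have hC : IsCompact (D '' ((Function.support f ×ˢ (inv '' Function.support g)) ∩ P)) :=
    (((isCompact_support hf).prod ((isCompact_support hg).image continuous_inv)).inter_right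
      hP).image_of_continuousOn (hD.mono Set.inter_subset_right)
  refine HasCompactSupport.intro hC fun γ hγ => ?_
  refine (finsum_congr fun α => ?_).trans finsum_zero
  by_contra h
  refine hγ ⟨(γ.div α.1 α.2, α.1.inv), ⟨⟨left_ne_zero_of_mul h, α.1, right_ne_zero_of_mul h, rfl⟩,
    rfl⟩, ?_⟩
  exact (dif_pos rfl).trans (ext rfl
    (show γ.deg + -α.1.deg + - -α.1.deg = γ.deg by ring) α.2)

theorem conv_mem (hσ : IsLHomeo σ) {f g : DR σ → K}
    (hf : f ∈ steinbergSubmodule K σ) (hg : g ∈ steinbergSubmodule K σ) :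
    conv f g ∈ steinbergSubmodule K σ :=
  ⟨isLocallyConstant_conv hσ hf hg, hasCompactSupport_conv hσ hf hg⟩

theorem one_mem (K : Type*) [Field K] (hσ : IsLHomeo σ) : one K σ ∈ steinbergSubmodule K σ := by
  have := hσ.metrizableSpace
  have := hσ.compactSpace
  have := t2Space (σ := σ)
  have h0 : Set.range (unit σ) = cyl σ Set.univ 0 0 Set.univ := by
    ext γ
    rw [mem_range_unit]
    constructor
    · rintro ⟨h1, h2⟩
      exact ⟨trivial, trivial, by simpa using h2, h1⟩
    · rintro ⟨-, -, h1, h2⟩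
      exact ⟨h2, by simpa using h1⟩
  have hu : Continuous (unit σ) := by
    refine continuous_generateFrom_iff.2 ?_
    rintro _ ⟨U, V, m, n, hU, hV, rfl⟩
    by_cases h : m = n
    · have : unit σ ⁻¹' cyl σ U m n V = U ∩ V := by
        subst h
        ext x
        simp [cyl]
      rw [this]
      exact hU.inter hV
    · have : unit σ ⁻¹' cyl σ U m n V = ∅ := by
        refine Set.eq_empty_of_forall_notMem fun x hx => h ?_
        have := hx.2.2.1
        rw [deg_unit] at this
        omega
      rw [this]
      exact isOpen_empty
  have hcpt : IsCompact (Set.range (unit σ)) := isCompact_range hu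
  have hclopen : IsClopen (Set.range (unit σ)) :=
    ⟨hcpt.isClosed, h0 ▸ isOpen_cyl 0 0 isOpen_univ isOpen_univ⟩
  have hloc : IsLocallyConstant (one K σ) := by
    refine (IsLocallyConstant.iff_exists_open _).2 fun γ => ?_
    by_cases h : γ ∈ Set.range (unit σ)
    · exact ⟨_, hclopen.isOpen, h, fun β hβ => by
        rw [one, Set.indicator_of_mem hβ, Set.indicator_of_mem h]; rfl⟩
    · exact ⟨_, hclopen.compl.isOpen, h, fun β hβ => by
        rw [one, Set.indicator_of_notMem hβ, Set.indicator_of_notMem h]⟩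
  refine ⟨hloc, ?_⟩
  exact HasCompactSupport.intro hcpt fun γ hγ => Set.indicator_of_notMem hγ _

theorem star_mem [StarRing K] {f : DR σ → K} (hf : f ∈ steinbergSubmodule K σ) :
    (fun γ : DR σ => star (f γ.inv)) ∈ steinbergSubmodule K σ := by
  have h : IsLocallyConstant fun γ : DR σ => star (f γ.inv) :=
    (hf.1.comp_continuous continuous_inv).comp star
  refine ⟨h, ?_⟩
  have e : Function.support (fun γ : DR σ => star (f γ.inv)) = inv '' Function.support f := by
    ext γ
    simp only [Function.mem_support, ne_eq, star_eq_zero, Set.mem_image]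
    exact ⟨fun h => ⟨_, h, inv_inv γ⟩, fun ⟨β, hβ, h⟩ => by rw [← h, inv_inv]; exact hβ⟩
  rw [HasCompactSupport, tsupport, IsClosed.closure_eq]
  · rw [e]
    exact (isCompact_support hf).image continuous_inv
  · exact (h.isOpen_fiber 0).isClosed_compl

theorem add_conv (hσ : IsLHomeo σ) (f f' : DR σ → K) {g : DR σ → K}
    (hg : g ∈ steinbergSubmodule K σ) : conv (f + f') g = conv f g + conv f' g := by
  funext γ
  simp only [conv, Pi.add_apply, add_mul]
  exact finsum_add_distrib (finite_conv hσ f hg γ) (finite_conv hσ f' hg γ)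

theorem conv_add (hσ : IsLHomeo σ) (f : DR σ → K) {g g' : DR σ → K}
    (hg : g ∈ steinbergSubmodule K σ) (hg' : g' ∈ steinbergSubmodule K σ) :
    conv f (g + g') = conv f g + conv f g' := by
  funext γ
  simp only [conv, Pi.add_apply, mul_add]
  exact finsum_add_distrib (finite_conv hσ f hg γ) (finite_conv hσ f hg' γ)

theorem star_conv [StarRing K] (hσ : IsLHomeo σ) (f : DR σ → K) {g : DR σ → K}
    (hg : g ∈ steinbergSubmodule K σ) :
    (fun γ : DR σ => star (conv f g γ.inv)) =
      conv (fun γ => star (g γ.inv)) (fun γ => star (f γ.inv)) := by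
  funext γ
  have h := (starAddEquiv (R := K)).toAddMonoidHom.map_finsum (finite_conv hσ f hg γ.inv)
  refine h.trans ?_
  rw [← finsum_comp_equiv (starEquiv γ), conv]
  refine finsum_congr fun α => ?_
  change star (_ * _) = _
  rw [star_mul]
  have e1 : ((starEquiv γ) α).1 = (γ.div α.1 α.2).inv :=
    ext rfl (show α.1.deg + -γ.deg = -(γ.deg + -α.1.deg) by ring) rfl
  have e2 : γ.inv.div ((starEquiv γ) α).1 ((starEquiv γ) α).2 = α.1.inv :=
    ext α.2.symm (show -γ.deg + -(α.1.deg + -γ.deg) = -α.1.deg by ring) rfl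
  rw [e2, congrArg g e1]

theorem conv_assoc (hσ : IsLHomeo σ) (f : DR σ → K) {g h : DR σ → K}
    (hg : g ∈ steinbergSubmodule K σ) (hh : h ∈ steinbergSubmodule K σ) :
    conv (conv f g) h = conv f (conv g h) := by
  classical
  funext γ
  let F : {α : DR σ // α.src = γ.src} → {δ : DR σ // δ.src = γ.src} → K := fun α δ =>
    f (γ.div δ.1 δ.2) * g (δ.1.div α.1 (α.2.trans δ.2.symm)) * h α.1
  have hL : conv (conv f g) h γ = ∑ᶠ α, ∑ᶠ δ, F α δ := by
    refine finsum_congr fun α => ?_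
    rw [conv, ← finsum_comp_equiv (fiberEquiv γ α.1 α.2), finsum_mul]
    refine finsum_congr fun δ => ?_
    congr 2
    exact congrArg f (ext rfl
      (show γ.deg + -α.1.deg + -(δ.1.deg + -α.1.deg) = γ.deg + -δ.1.deg by ring) rfl)
  have hR : conv f (conv g h) γ = ∑ᶠ δ, ∑ᶠ α, F α δ := by
    refine finsum_congr fun δ => ?_
    rw [conv_eq g h δ.1 δ.2, mul_finsum]
    exact finsum_congr fun α => (mul_assoc _ _ _).symm
  have hA : {α : {α : DR σ // α.src = γ.src} | h α.1 ≠ 0}.Finite :=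
    Set.Finite.subset ((finite_fiber hσ (isCompact_support hh) γ.src).preimage
      Subtype.val_injective.injOn) fun α hα => ⟨hα, α.2⟩
  have hB : ∀ α : {α : DR σ // α.src = γ.src}, {δ : {δ : DR σ // δ.src = γ.src} |
      g (δ.1.div α.1 (α.2.trans δ.2.symm)) ≠ 0}.Finite := by
    intro α
    refine Set.Finite.subset ((finite_fiber hσ (isCompact_support hg)
      (γ.div α.1 α.2).src).preimage (f := fun δ => ((fiberEquiv γ α.1 α.2) δ).1)
      (Subtype.val_injective.comp (Equiv.injective _)).injOn) fun δ hδ => ⟨hδ, rfl⟩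
  let A := hA.toFinset
  let D := A.biUnion fun α => (hB α).toFinset
  have hF : ∀ α δ, F α δ ≠ 0 → α ∈ A ∧ δ ∈ D := by
    intro α δ h0
    have h1 : α ∈ A := hA.mem_toFinset.2 (right_ne_zero_of_mul h0)
    exact ⟨h1, Finset.mem_biUnion.2 ⟨α, h1, (hB α).mem_toFinset.2
      (right_ne_zero_of_mul (left_ne_zero_of_mul h0))⟩⟩
  have h1 : ∀ α, ∑ᶠ δ, F α δ = ∑ δ ∈ D, F α δ := fun α =>
    finsum_eq_sum_of_support_subset _ fun δ hδ => (hF α δ hδ).2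
  have h2 : ∀ δ, ∑ᶠ α, F α δ = ∑ α ∈ A, F α δ := fun δ =>
    finsum_eq_sum_of_support_subset _ fun α hα => (hF α δ hα).1
  rw [hL, hR, finsum_congr h1, finsum_congr h2, finsum_eq_sum_of_support_subset (s := A),
    finsum_eq_sum_of_support_subset (s := D), Finset.sum_comm]
  · intro δ hδ
    obtain ⟨α, -, h0⟩ := Finset.exists_ne_zero_of_sum_ne_zero hδ
    exact (hF α δ h0).2
  · intro α hα
    obtain ⟨δ, -, h0⟩ := Finset.exists_ne_zero_of_sum_ne_zero hα
    exact (hF α δ h0).1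

end DR

/-- The Steinberg algebra `A_K(𝒢(X, σ))` of the Deaconu-Renault groupoid of `(X, σ)`. -/
def Steinberg (K : Type*) [Field K] {X : Type*} [TopologicalSpace X] {σ : X → X}
    (_ : IsLHomeo σ) : Type _ :=
  steinbergSubmodule K σ

namespace Steinberg

variable {K : Type*} [Field K] {X : Type*} [TopologicalSpace X] {σ : X → X} {hσ : IsLHomeo σ}

instance : CoeFun (Steinberg K hσ) fun _ => DR σ → K := ⟨fun f => f.1⟩

instance : AddCommGroup (Steinberg K hσ) := inferInstanceAs (AddCommGroup (steinbergSubmodule K σ))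

instance : Module K (Steinberg K hσ) := inferInstanceAs (Module K (steinbergSubmodule K σ))

/-- The product is convolution; the unit is the indicator function of the unit space. -/
noncomputable instance : Ring (Steinberg K hσ) where
  __ := (inferInstance : AddCommGroup (Steinberg K hσ))
  mul f g := ⟨DR.conv f.1 g.1, DR.conv_mem hσ f.2 g.2⟩
  one := ⟨DR.one K σ, DR.one_mem K hσ⟩
  left_distrib f g h := Subtype.ext (DR.conv_add hσ f.1 g.2 h.2)
  right_distrib f g h := Subtype.ext (DR.add_conv hσ f.1 g.1 h.2)
  zero_mul f := Subtype.ext (DR.zero_conv f.1)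
  mul_zero f := Subtype.ext (DR.conv_zero f.1)
  mul_assoc f g h := Subtype.ext (DR.conv_assoc hσ f.1 g.2 h.2)
  one_mul f := Subtype.ext (DR.one_conv f.1)
  mul_one f := Subtype.ext (DR.conv_one f.1)

noncomputable instance : Algebra K (Steinberg K hσ) :=
  Algebra.ofModule (fun c f g => Subtype.ext (DR.smul_conv c f.1 g.1))
    (fun c f g => Subtype.ext (DR.conv_smul c f.1 g.1))

/-- The involution `f^*(γ) = f(γ⁻¹)^*`. -/
noncomputable instance [StarRing K] : StarRing (Steinberg K hσ) where
  __ := (inferInstance : AddCommGroup (Steinberg K hσ))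
  star f := ⟨fun γ => star (f.1 γ.inv), DR.star_mem f.2⟩
  star_involutive f := Subtype.ext (funext fun γ => by simp)
  star_add f g := Subtype.ext (funext fun γ => star_add _ _)
  star_mul f g := Subtype.ext (DR.star_conv hσ f.1 g.2)

instance [StarRing K] : StarModule K (Steinberg K hσ) :=
  ⟨fun c f => Subtype.ext (funext fun γ => star_mul' c (f.1 γ.inv))⟩

end Steinberg

/-- A finite bipartite separated graph, with vertex sets `V0 = E^{0,0}` and `V1 = E^{0,1}`. Every
edge goes from `V1` to `V0`. The separation is encoded by the finite set `Col` of colours: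
`col e` is the colour of `e`, and the elements of `C_v` are the sets `{e | col e = c}` for the
colours `c` with `vert c = v`. -/
structure SepGraph : Type (u + 1) where
  V0 : Type u
  V1 : Type u
  Edge : Type u
  Col : Type u
  finV0 : Finite V0
  finV1 : Finite V1
  finEdge : Finite Edge
  finCol : Finite Col
  col : Edge → Col
  vert : Col → V0
  src : Edge → V1
  col_surjective : Function.Surjective col
  vert_surjective : Function.Surjective vert
  src_surjective : Function.Surjective src

namespace SepGraph

/-- The range of an edge. -/
def rng (E : SepGraph.{u}) (e : E.Edge) : E.V0 := E.vert (E.col e)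

/-- The `1`-step resolution. A vertex `v(x_1, …, x_k)` in the lower layer consists of a vertex
`u ∈ E^{0,0}` together with a choice of one edge out of each element of `C_u`. The edge
`α^{x_i}(x_1, …, x_{i-1}, x_{i+1}, …, x_k)` is given by the vertex `v(x_1, …, x_k)` (its source)
and the colour of `x_i`. Its range is `s(x_i)` and it belongs to the set `X(x_i)`, so that the
colours of the resolution are the edges of `E`. -/
def resolution (E : SepGraph.{u}) : SepGraph.{u} where
  V0 := E.V1
  V1 := Σ u : E.V0, ∀ c : {c : E.Col // E.vert c = u}, {x : E.Edge // E.col x = c.1}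
  Edge := Σ w : (Σ u : E.V0, ∀ c : {c : E.Col // E.vert c = u}, {x : E.Edge // E.col x = c.1}),
    {c : E.Col // E.vert c = w.1}
  Col := E.Edge
  finV0 := E.finV1
  finV1 := by
    have := E.finV0; have := E.finCol; have := E.finEdge
    infer_instance
  finEdge := by
    have := E.finV0; have := E.finCol; have := E.finEdge
    infer_instance
  finCol := E.finEdge
  col a := (a.1.2 a.2).1
  vert := E.src
  src a := a.1
  col_surjective x := by
    classical
    choose g hg using E.col_surjective
    refine ⟨⟨⟨E.rng x, fun c => if h : E.col x = c.1 then ⟨x, h⟩ else ⟨g c.1, hg c.1⟩⟩,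
      ⟨E.col x, rfl⟩⟩, ?_⟩
    simp
  vert_surjective := E.src_surjective
  src_surjective w := by
    obtain ⟨c, hc⟩ := E.vert_surjective w.1
    exact ⟨⟨w, ⟨c, hc⟩⟩, rfl⟩

end SepGraph

/-- A generalized finite shift graph: a finite bipartite separated graph with vertex sets `V0` and
`V1`, blue edges `B` and red edges `R`, the separation at `v ∈ V0` being `C_v = {B_v, R_v}`,
where `B_v` and `R_v` are the sets of blue and red edges with range `v`. Both are nonempty for
all `v`, every vertex in `V1` is the source of exactly one blue edge, and of at least
one red edge. -/
structure GFSGraph : Type (u + 1) where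
  V0 : Type u
  V1 : Type u
  B : Type u
  R : Type u
  finV0 : Finite V0
  finV1 : Finite V1
  finB : Finite B
  finR : Finite R
  rB : B → V0
  sB : B → V1
  rR : R → V0
  sR : R → V1
  rB_surjective : Function.Surjective rB
  rR_surjective : Function.Surjective rR
  sB_bijective : Function.Bijective sB
  sR_surjective : Function.Surjective sR

namespace GFSGraph

variable (G : GFSGraph.{u})

/-- The underlying separated graph. The colours are `B_v` (`Sum.inl v`) and `R_v` (`Sum.inr v`). -/
def toSepGraph : SepGraph.{u} where
  V0 := G.V0
  V1 := G.V1
  Edge := G.B ⊕ G.R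
  Col := G.V0 ⊕ G.V0
  finV0 := G.finV0
  finV1 := G.finV1
  finEdge := by
    have := G.finB; have := G.finR
    infer_instance
  finCol := by
    have := G.finV0
    infer_instance
  col := Sum.map G.rB G.rR
  vert := Sum.elim id id
  src := Sum.elim G.sB G.sR
  col_surjective := Sum.map_surjective.2 ⟨G.rB_surjective, G.rR_surjective⟩
  vert_surjective v := ⟨Sum.inl v, rfl⟩
  src_surjective w := by
    obtain ⟨f, hf⟩ := G.sR_surjective w
    exact ⟨Sum.inr f, hf⟩

/-- The `n`-step resolution `(E_n, C^n)`, which is the `n`-th layer of the canonical resolution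
`(F, D)`. In particular `F^{0,n}` is `(G.layer n).V0`, and `(G.layer n).V1` is by definition the
same as `(G.layer (n + 1)).V0`. -/
def layer : ℕ → SepGraph.{u}
  | 0 => G.toSepGraph
  | n + 1 => (layer n).resolution

/-- The blue edges of the canonical resolution. In the first layer these are the blue edges of the
graph. At a vertex `v ∈ F^{0,n+1}` the separation is `D_v = {X(x) | s(x) = v}`; there is exactly
one blue edge `e` with source `v`, and the set of blue edges at `v` is `X(e)`. -/
def IsBlue : (n : ℕ) → (G.layer n).Edge → Prop
  | 0 => fun e => Sum.isLeft (α := G.B) (β := G.R) e = true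
  | n + 1 => fun a => IsBlue n ((G.layer (n + 1)).col a)

/-- `(e₀, e₁, f₀, f₁)` is a romb with top vertex in `F^{0,n}`: `(e₀, e₁)` is a path of
blue edges, `(f₀, f₁)` is a path of red edges, and both have the same ranges and sources. -/
def IsRomb (n : ℕ) (e₀ f₀ : (G.layer n).Edge) (e₁ f₁ : (G.layer (n + 1)).Edge) : Prop :=
  G.IsBlue n e₀ ∧ G.IsBlue (n + 1) e₁ ∧ ¬ G.IsBlue n f₀ ∧ ¬ G.IsBlue (n + 1) f₁ ∧
    (G.layer (n + 1)).rng e₁ = (G.layer n).src e₀ ∧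
    (G.layer (n + 1)).rng f₁ = (G.layer n).src f₀ ∧
    (G.layer n).rng e₀ = (G.layer n).rng f₀ ∧
    (G.layer (n + 1)).src e₁ = (G.layer (n + 1)).src f₁

/-- The space of infinite paths of blue edges in the canonical resolution. -/
def Path : Type u :=
  {e : ∀ n, (G.layer n).Edge // ∀ n, G.IsBlue n (e n) ∧
    (G.layer (n + 1)).rng (e (n + 1)) = (G.layer n).src (e n)}

/-- The topology generated by the cylinder sets, that is, the subspace topology from the product
of the discrete spaces `F^{1,n}`. -/
instance : TopologicalSpace G.Path :=
  TopologicalSpace.induced (fun e : G.Path => e.1)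
    (@Pi.topologicalSpace ℕ (fun n => (G.layer n).Edge) fun _ => ⊥)

/-- `y` is obtained from `x` as follows: every pair `(x_{2j}, x_{2j+1})` of blue edges is completed
to a romb by red edges `(f_{2j}, f_{2j+1})` with `f_{2j+1} ∈ R(f_{2j}) = X(f_{2j})`, and then
every pair `(f_{2j+1}, f_{2j+2})` is completed to a romb by the blue edges
`(y_{2j+1}, y_{2j+2})`. -/
def ShiftRel (x y : G.Path) : Prop :=
  ∃ f : ∀ n, (G.layer n).Edge, ∀ j,
    (G.IsRomb (2 * j) (x.1 (2 * j)) (f (2 * j)) (x.1 (2 * j + 1)) (f (2 * j + 1)) ∧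
      (G.layer (2 * j + 1)).col (f (2 * j + 1)) = f (2 * j)) ∧
    G.IsRomb (2 * j + 1) (y.1 (2 * j + 1)) (f (2 * j + 1)) (y.1 (2 * j + 2)) (f (2 * j + 2))

/-- Whether an element of the separation consists of blue edges. -/
def IsBlueCol : (n : ℕ) → (G.layer n).Col → Prop
  | 0 => fun c => Sum.isLeft (α := G.V0) (β := G.V0) c = true
  | n + 1 => fun e => G.IsBlue n e

theorem isBlue_iff : ∀ (n : ℕ) (e : (G.layer n).Edge),
    G.IsBlue n e ↔ G.IsBlueCol n ((G.layer n).col e)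
  | 0, Sum.inl _ => Iff.rfl
  | 0, Sum.inr _ => Iff.rfl
  | _ + 1, _ => Iff.rfl

/-- An edge in the layer `n + 1` is determined by its source and its colour in the layer `n`. -/
theorem edge_ext {n : ℕ} {a b : (G.layer (n + 1)).Edge}
    (h : (G.layer (n + 1)).src a = (G.layer (n + 1)).src b)
    (hc : (G.layer n).col ((G.layer (n + 1)).col a) =
      (G.layer n).col ((G.layer (n + 1)).col b)) : a = b := by
  obtain ⟨w, c⟩ := a
  obtain ⟨w', c'⟩ := b
  have h : w = w' := h
  subst h
  have e1 : (G.layer n).col (w.2 c).1 = c.1 := (w.2 c).2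
  have e2 : (G.layer n).col (w.2 c').1 = c'.1 := (w.2 c').2
  exact congrArg (Sigma.mk w) (Subtype.ext (e1.symm.trans (hc.trans e2)))

theorem exists_edge {n : ℕ} (w : (G.layer (n + 1)).V1) (c : (G.layer n).Col)
    (hc : (G.layer n).vert c = w.1) : ∃ a : (G.layer (n + 1)).Edge,
      (G.layer (n + 1)).src a = w ∧ (G.layer n).col ((G.layer (n + 1)).col a) = c :=
  ⟨⟨w, ⟨c, hc⟩⟩, rfl, (w.2 ⟨c, hc⟩).2⟩

theorem vert_col {n : ℕ} (a : (G.layer (n + 1)).Edge) :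
    (G.layer n).rng ((G.layer (n + 1)).col a) = ((G.layer (n + 1)).src a).1 := by
  obtain ⟨w, c⟩ := a
  have e1 : (G.layer n).col (w.2 c).1 = c.1 := (w.2 c).2
  exact (congrArg (G.layer n).vert e1).trans c.2

theorem existsUnique_blue_aux (n : ℕ) :
    (∀ u : (G.layer n).V0, ∃! c, (G.layer n).vert c = u ∧ G.IsBlueCol n c) ∧
    (∀ w : (G.layer n).V1, ∃! e, (G.layer n).src e = w ∧ G.IsBlue n e) := by
  induction n with
  | zero =>
    constructor
    · intro u
      refine ⟨Sum.inl u, ⟨rfl, rfl⟩, ?_⟩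
      rintro (c | c) ⟨h1, h2⟩
      · exact congrArg Sum.inl h1
      · cases h2
    · intro w
      obtain ⟨e, he, huniq⟩ := (Function.bijective_iff_existsUnique _).1 G.sB_bijective w
      refine ⟨Sum.inl e, ⟨he, rfl⟩, ?_⟩
      rintro (c | c) ⟨h1, h2⟩
      · exact congrArg Sum.inl (huniq c h1)
      · cases h2
  | succ n ih =>
    refine ⟨ih.2, fun w => ?_⟩
    obtain ⟨c, ⟨hc1, hc2⟩, huniq⟩ := ih.1 w.1
    obtain ⟨a, ha1, ha2⟩ := G.exists_edge w c hc1
    refine ⟨a, ⟨ha1, ?_⟩, ?_⟩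
    · refine (G.isBlue_iff n _).2 ?_
      rw [ha2]
      exact hc2
    · rintro b ⟨hb1, hb2⟩
      refine G.edge_ext (hb1.trans ha1.symm) ((huniq _ ⟨?_, (G.isBlue_iff n _).1 hb2⟩).trans
        ha2.symm)
      exact (G.vert_col b).trans (congrArg Sigma.fst hb1)

theorem existsUnique_blue (n : ℕ) (w : (G.layer n).V1) :
    ∃! e, (G.layer n).src e = w ∧ G.IsBlue n e :=
  (G.existsUnique_blue_aux n).2 w

theorem existsUnique_red_aux (j : ℕ) :
    (∀ u : (G.layer (2 * j)).V0, ∃! c, (G.layer (2 * j)).vert c = u ∧ ¬ G.IsBlueCol (2 * j) c) ∧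
    (∀ w : (G.layer (2 * j + 1)).V1, ∃! f, (G.layer (2 * j + 1)).src f = w ∧
      ¬ G.IsBlue (2 * j + 1) f) := by
  have step : ∀ n, (∀ u : (G.layer n).V0, ∃! c, (G.layer n).vert c = u ∧ ¬ G.IsBlueCol n c) →
      (∀ w : (G.layer (n + 1)).V1, ∃! f, (G.layer (n + 1)).src f = w ∧ ¬ G.IsBlue (n + 1) f) := by
    intro n ih w
    obtain ⟨c, ⟨hc1, hc2⟩, huniq⟩ := ih w.1
    obtain ⟨a, ha1, ha2⟩ := G.exists_edge w c hc1
    refine ⟨a, ⟨ha1, fun h => ?_⟩, ?_⟩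
    · have h := (G.isBlue_iff n _).1 h
      rw [ha2] at h
      exact hc2 h
    · rintro b ⟨hb1, hb2⟩
      refine G.edge_ext (hb1.trans ha1.symm)
        ((huniq _ ⟨?_, fun h => hb2 ((G.isBlue_iff n _).2 h)⟩).trans ha2.symm)
      exact (G.vert_col b).trans (congrArg Sigma.fst hb1)
  induction j with
  | zero =>
    have h0 : ∀ u : (G.layer 0).V0, ∃! c, (G.layer 0).vert c = u ∧ ¬ G.IsBlueCol 0 c := by
      intro u
      refine ⟨Sum.inr u, ⟨rfl, fun h => by cases h⟩, ?_⟩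
      rintro (c | c) ⟨h1, h2⟩
      · exact absurd rfl h2
      · exact congrArg Sum.inr h1
    exact ⟨h0, step 0 h0⟩
  | succ j ih => exact ⟨ih.2, step (2 * j + 2) ih.2⟩

/-- In a layer `2j + 1` every vertex is the source of exactly one red edge. -/
theorem existsUnique_red (j : ℕ) (w : (G.layer (2 * j + 1)).V1) :
    ∃! f, (G.layer (2 * j + 1)).src f = w ∧ ¬ G.IsBlue (2 * j + 1) f :=
  (G.existsUnique_red_aux j).2 w

theorem col_path (x : G.Path) (n : ℕ) : (G.layer (n + 1)).col (x.1 (n + 1)) = x.1 n :=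
  (G.existsUnique_blue n _).unique ⟨rfl, (x.2 (n + 1)).1⟩ ⟨(x.2 n).2.symm, (x.2 n).1⟩

theorem existsUnique_shift (x : G.Path) : ∃! y : G.Path, G.ShiftRel x y := by
  have hf : ∀ n, ∃ e : (G.layer n).Edge,
      (∀ j, n = 2 * j + 1 → (G.layer n).src e = (G.layer n).src (x.1 n) ∧ ¬ G.IsBlue n e) ∧
      (∀ j, n = 2 * j → ∃ a : (G.layer (n + 1)).Edge, ¬ G.IsBlue (n + 1) a ∧
        (G.layer (n + 1)).src a = (G.layer (n + 1)).src (x.1 (n + 1)) ∧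
        (G.layer (n + 1)).col a = e) := by
    intro n
    rcases Nat.even_or_odd' n with ⟨j, rfl | rfl⟩
    · obtain ⟨a, ⟨h1, h2⟩, -⟩ := G.existsUnique_red j ((G.layer (2 * j + 1)).src (x.1 (2 * j + 1)))
      exact ⟨_, fun i hi => by omega, fun i _ => ⟨a, h2, h1, rfl⟩⟩
    · obtain ⟨a, ⟨h1, h2⟩, -⟩ := G.existsUnique_red j ((G.layer (2 * j + 1)).src (x.1 (2 * j + 1)))
      exact ⟨a, fun i _ => ⟨h1, h2⟩, fun i hi => by omega⟩
  choose f hf1 hf2 using hf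
  have hodd : ∀ j, (G.layer (2 * j + 1)).src (f (2 * j + 1)) =
      (G.layer (2 * j + 1)).src (x.1 (2 * j + 1)) ∧ ¬ G.IsBlue (2 * j + 1) (f (2 * j + 1)) :=
    fun j => hf1 _ j rfl
  have hcol : ∀ j, (G.layer (2 * j + 1)).col (f (2 * j + 1)) = f (2 * j) := by
    intro j
    obtain ⟨a, h1, h2, h3⟩ := hf2 _ j rfl
    rw [← h3, (G.existsUnique_red j _).unique (hodd j) ⟨h2, h1⟩]
  have heven : ∀ j, ¬ G.IsBlue (2 * j) (f (2 * j)) := fun j h => by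
    rw [← hcol j] at h
    exact (hodd j).2 h
  have hrng : ∀ j, (G.layer (2 * j)).rng (x.1 (2 * j)) = (G.layer (2 * j)).rng (f (2 * j)) := by
    intro j
    rw [← hcol j, ← G.col_path x (2 * j), vert_col, vert_col, (hodd j).1]
  have hcol2 : ∀ j, (G.layer (2 * j + 2)).col (f (2 * j + 2)) = f (2 * j + 1) := by
    intro j
    refine (G.existsUnique_red j _).unique ⟨rfl, heven (j + 1)⟩ ⟨?_, (hodd j).2⟩
    exact (hodd j).1.trans ((x.2 (2 * j + 1)).2.symm.trans (hrng (j + 1)))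
  choose b hb1 hb2 using fun n (w : (G.layer n).V1) => (G.existsUnique_blue n w).exists
  have hy : ∀ n, ∃ e : (G.layer n).Edge,
      (∀ j, n = 2 * j → e = b n ((G.layer n).src (f n))) ∧
      (∀ j, n = 2 * j + 1 → e = (G.layer (n + 1)).col
        (b (n + 1) ((G.layer (n + 1)).src (f (n + 1))))) := by
    intro n
    rcases Nat.even_or_odd' n with ⟨j, rfl | rfl⟩
    · exact ⟨_, fun i _ => rfl, fun i hi => by omega⟩
    · exact ⟨_, fun i hi => by omega, fun i _ => rfl⟩
  choose y hy1 hy2 using hy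
  have hy1 : ∀ j, y (2 * j) = b (2 * j) ((G.layer (2 * j)).src (f (2 * j))) :=
    fun j => hy1 _ j rfl
  have hy2 : ∀ j, y (2 * j + 1) = (G.layer (2 * j + 2)).col (y (2 * j + 2)) := fun j => by
    rw [hy2 _ j rfl]
    exact congrArg _ (hy1 (j + 1)).symm
  have hye : ∀ j, (G.layer (2 * j)).src (y (2 * j)) = (G.layer (2 * j)).src (f (2 * j)) ∧
      G.IsBlue (2 * j) (y (2 * j)) := fun j => by
    rw [hy1 j]
    exact ⟨hb1 _ _, hb2 _ _⟩
  have hyr : ∀ j, (G.layer (2 * j + 1)).rng (y (2 * j + 1)) =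
      (G.layer (2 * j + 1)).rng (f (2 * j + 1)) := by
    intro j
    rw [hy2 j, ← hcol2 j, vert_col, vert_col]
    exact congrArg _ (hye (j + 1)).1
  have hyo : ∀ j, G.IsBlue (2 * j + 1) (y (2 * j + 1)) := fun j => by
    rw [hy2 j]
    exact (hye (j + 1)).2
  have hpath : ∀ n, G.IsBlue n (y n) ∧
      (G.layer (n + 1)).rng (y (n + 1)) = (G.layer n).src (y n) := by
    intro n
    rcases Nat.even_or_odd' n with ⟨j, rfl | rfl⟩
    · refine ⟨(hye j).2, ?_⟩
      rw [hyr j, (hye j).1, ← hcol j]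
      rfl
    · refine ⟨hyo j, ?_⟩
      rw [hy2 j]
      rfl
  refine ⟨⟨y, hpath⟩, ⟨f, fun j => ⟨⟨⟨(x.2 _).1, (x.2 _).1, heven j, (hodd j).2, (x.2 _).2, ?_,
    hrng j, (hodd j).1.symm⟩, hcol j⟩, ⟨hyo j, (hye (j + 1)).2, (hodd j).2, heven (j + 1),
    (hpath _).2, ?_, hyr j, (hye (j + 1)).1⟩⟩⟩, ?_⟩
  · rw [← hcol j]
    rfl
  · rw [← hcol2 j]
    rfl
  · rintro z ⟨g, hg⟩
    have hg1 : ∀ j, g (2 * j) = f (2 * j) := fun j => by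
      rw [← (hg j).1.2, ← hcol j]
      exact congrArg _ ((G.existsUnique_red j _).unique
        ⟨(hg j).1.1.2.2.2.2.2.2.2.symm, (hg j).1.1.2.2.2.1⟩ (hodd j))
    have hz : ∀ j, z.1 (2 * j + 2) = y (2 * j + 2) := fun j => by
      refine (G.existsUnique_blue _ _).unique
        ⟨(hg j).2.2.2.2.2.2.2.2, (z.2 _).1⟩ ⟨?_, (hpath _).1⟩
      exact ((hye (j + 1)).1).trans (congrArg _ (hg1 (j + 1)).symm)
    have hdown : ∀ n, z.1 (n + 1) = y (n + 1) → z.1 n = y n := fun n h =>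
      (G.existsUnique_blue n _).unique ⟨(z.2 n).2.symm, (z.2 n).1⟩
        ⟨(hpath n).2.symm.trans (congrArg _ h.symm), (hpath n).1⟩
    refine Subtype.ext (funext fun n => ?_)
    rcases Nat.even_or_odd' n with ⟨j, rfl | rfl⟩
    · exact hdown _ (hdown _ (hz j))
    · exact hdown _ (hz j)

/-- The map `σ` of the generalized finite shift `(X, σ)` associated to the graph. -/
noncomputable def shift (x : G.Path) : G.Path :=
  (G.existsUnique_shift x).choose

/-- The defining property of `σ`. -/
theorem shiftRel_shift (x : G.Path) : G.ShiftRel x (G.shift x) :=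
  (G.existsUnique_shift x).choose_spec.1

/-- The set `Z(e)` of all paths `(x_0, x_1, …)` with `x_0 = e`. -/
def cylBlue (e : G.B) : Set G.Path := {x | x.1 0 = (Sum.inl e : G.B ⊕ G.R)}

/-- The set of all paths `(x_0, x_1, …)` such that the romb `(x_0, x_1, f_0, f_1)`, with
`f_1 ∈ R(f_0)`, satisfies `f_0 = f`. -/
def cylRed (f : G.R) : Set G.Path :=
  {x | ∃ f₁ : (G.layer 1).Edge, G.IsRomb 0 (x.1 0) (Sum.inr f : G.B ⊕ G.R) (x.1 1) f₁ ∧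
    (G.layer 1).col f₁ = (Sum.inr f : G.B ⊕ G.R)}

end GFSGraph

/-- An `(E, C)`-structure on `(Y, ρ)`: for every blue edge `e` a set `Z_e`, and for every red edge
`f` from `s(e)` to `v`, a set `W_f` (these are the sets `W_{e,v}^{(k)}`, as `f` runs over the
`a_{e,v}` red edges from `s(e)` to `v`). They are nonempty compact open sets such that
`Y` is the disjoint union of the sets `Z_e`, for every `v` the union of the sets `Z_e` with
`e ∈ B_v` is the disjoint union of the sets `W_f` with `f ∈ R_v`, and `ρ` maps `W_f` injectively
onto `Z_e` if `s(e) = s(f)`. -/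
structure ECStructure (G : GFSGraph.{u}) {Y : Type v} [TopologicalSpace Y] (ρ : Y → Y) where
  Z : G.B → Set Y
  W : G.R → Set Y
  isOpen_Z : ∀ e, IsOpen (Z e)
  isCompact_Z : ∀ e, IsCompact (Z e)
  nonempty_Z : ∀ e, (Z e).Nonempty
  isOpen_W : ∀ f, IsOpen (W f)
  isCompact_W : ∀ f, IsCompact (W f)
  nonempty_W : ∀ f, (W f).Nonempty
  disjoint_Z : ∀ e e', e ≠ e' → Disjoint (Z e) (Z e')
  iUnion_Z : ⋃ e, Z e = Set.univ
  disjoint_W : ∀ f f', f ≠ f' → Disjoint (W f) (W f')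
  union_eq : ∀ v, ⋃ e ∈ {e | G.rB e = v}, Z e = ⋃ f ∈ {f | G.rR f = v}, W f
  injOn : ∀ f, Set.InjOn ρ (W f)
  image_eq : ∀ e f, G.sB e = G.sR f → ρ '' W f = Z e

/-- A map `ψ` is `(E, C)`-equivariant with respect to given `(E, C)`-structures. -/
structure IsEquivariant {G : GFSGraph.{u}} {Y : Type v} [TopologicalSpace Y] {ρ : Y → Y}
    {X : Type w} [TopologicalSpace X] {σ : X → X} (S : ECStructure G ρ) (T : ECStructure G σ)
    (ψ : Y → X) : Prop where
  image_Z : ∀ e, ψ '' S.Z e ⊆ T.Z e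
  image_W : ∀ f, ψ '' S.W f ⊆ T.W f
  semiconj : Function.Semiconj ψ ρ σ

/-! A path `x` and its shift are tied together by one sequence of red edges, `redThread x`, in which
each term is the colour of the next. Its odd terms start at the nodes of `x`, its even terms at the
nodes of `G.shift x`. A red edge in an odd layer is determined by its source, so `x` determines its
thread. A red edge in a later even layer is determined by its source together with the edge two
layers before it, so the shift of `x` and the initial red edge determine the thread, hence `x`
(`eq_of_shift_eq`). Conversely, every path and every red edge at its node 0 arise in this way
(`exists_shift_eq`). Thus the shift maps the set of paths with initial red edge `f` bijectively onto
a blue cylinder. Compactness then makes a continuous map with such a structure a local homeomorphism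
(`ECStructure.isLocalHomeomorph`).

The map to the shift space is an itinerary. In each layer `n` the point `y` of `Y` gets a vertex `p
n y`, its cell. An edge moves points of the cell of its source to the cell of its range by
`transfer`: the identity if it is blue, `ρ` if it is red in an odd layer, and the inverse of `ρ` on
`W f` if it is red in an even layer with root `f`. The cell of `y` in layer `n + 2` records, for
every edge of layer `n` starting at `p n y`, the cell in layer `n + 1` of the transferred point
(`exists_coding`). The vertices `p n y` are the nodes of a path `ψ y`. Any equivariant map satisfies
the same recursion with the same initial data (`src_col_eq_node`), which gives uniqueness. Only
finitely many edges enter each step, and transfers are continuous at the points of their domains, so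
`ψ` is continuous.

For the groupoids, one needs only that `ψ` is bijective from each fibre of `ρ` onto the
corresponding fibre of the shift (`bijOn_fiber`): either fibre has exactly one point for each red
edge with the appropriate source. This passes to iterates and shows that preimages of groupoid
cylinders are cylinders with the same exponents (`DR.map_preimage_cyl`). Continuity, properness and
bijectivity on source fibres follow, and the last of these turns convolution sums into convolution
sums. -/

open Topology GFSGraph

/-! ### Constructing sequences -/

/-- A dependent function on `ℕ` with prescribed values at even and odd numbers. -/
theorem exists_eq_even_odd {F : ℕ → Type*} (a : ∀ j, F (2 * j)) (b : ∀ j, F (2 * j + 1)) :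
    ∃ f : ∀ n, F n, (∀ j, f (2 * j) = a j) ∧ ∀ j, f (2 * j + 1) = b j := by
  have h : ∀ n, ∃ x : F n, (∀ j (h : 2 * j = n), x = h ▸ a j) ∧
      ∀ j (h : 2 * j + 1 = n), x = h ▸ b j := by
    intro n
    rcases Nat.even_or_odd' n with ⟨j, rfl | rfl⟩
    · refine ⟨a j, fun i hi => ?_, fun i hi => by omega⟩
      obtain rfl : i = j := by omega
      rfl
    · refine ⟨b j, fun i hi => by omega, fun i hi => ?_⟩
      obtain rfl : i = j := by omega
      rfl
  choose f h1 h2 using h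
  exact ⟨f, fun j => h1 _ j rfl, fun j => h2 _ j rfl⟩

/-- Dependent choice along `ℕ`. -/
theorem exists_seq_of_forall_exists {A : ℕ → Type*} (r : ∀ n, A n → A (n + 1) → Prop) (a : A 0)
    (h : ∀ n x, ∃ y, r n x y) : ∃ s : ∀ n, A n, s 0 = a ∧ ∀ n, r n (s n) (s (n + 1)) := by
  choose g hg using h
  exact ⟨fun n => Nat.rec a (fun n x => g n x) n, rfl, fun n => hg n _⟩

/-! ### Vertices of the resolutions and nodes of paths -/

namespace GFSGraph

variable {G : GFSGraph.{u}}

theorem src_col_col {n : ℕ} (b : (G.layer (n + 2)).Edge) :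
    (G.layer n).src ((G.layer (n + 1)).col ((G.layer (n + 2)).col b)) =
      ((G.layer (n + 2)).src b).1 :=
  G.vert_col (n := n + 1) b

/-- A vertex of a resolution is determined by its top vertex and the edges it selects. -/
theorem vertex_ext {n : ℕ} {w w' : (G.layer (n + 1)).V1} (h1 : w.1 = w'.1)
    (h : ∀ b b' : (G.layer (n + 1)).Edge, (G.layer (n + 1)).src b = w →
      (G.layer (n + 1)).src b' = w' →
      (G.layer n).col ((G.layer (n + 1)).col b) = (G.layer n).col ((G.layer (n + 1)).col b') →
      (G.layer (n + 1)).col b = (G.layer (n + 1)).col b') : w = w' := by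
  obtain ⟨u, s⟩ := w
  obtain ⟨u', s'⟩ := w'
  have h1 : u = u' := h1
  subst h1
  refine congrArg (Sigma.mk u) (funext fun c => Subtype.ext ?_)
  exact h ⟨⟨u, s⟩, c⟩ ⟨⟨u, s'⟩, c⟩ rfl rfl ((s c).2.trans (s' c).2.symm)

/-- From the second resolution on, a selected edge is itself determined by its source and the colour
of its colour, so comparing sources is enough. This is the form in which codings are compared later.
-/
theorem vertex_ext_src {n : ℕ} {w w' : (G.layer (n + 2)).V1} (h1 : w.1 = w'.1)
    (h : ∀ b b' : (G.layer (n + 2)).Edge, (G.layer (n + 2)).src b = w →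
      (G.layer (n + 2)).src b' = w' →
      (G.layer (n + 1)).col ((G.layer (n + 2)).col b) =
        (G.layer (n + 1)).col ((G.layer (n + 2)).col b') →
      (G.layer (n + 1)).src ((G.layer (n + 2)).col b) =
        (G.layer (n + 1)).src ((G.layer (n + 2)).col b')) : w = w' :=
  vertex_ext h1 fun b b' hb hb' hc => G.edge_ext (h b b' hb hb' hc) (congrArg _ hc)

/-- A choice of one edge of each colour at `u` defines a vertex of the resolution. -/
theorem exists_vertex {n : ℕ} (u : (G.layer n).V0) (P : (G.layer n).Edge → Prop)
    (h : ∀ c, (G.layer n).vert c = u → ∃ x, (G.layer n).col x = c ∧ P x) :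
    ∃ w : (G.layer (n + 1)).V1, w.1 = u ∧
      ∀ b, (G.layer (n + 1)).src b = w → P ((G.layer (n + 1)).col b) := by
  choose s hs hP using h
  refine ⟨⟨u, fun c => ⟨s c.1 c.2, hs _ _⟩⟩, rfl, ?_⟩
  rintro ⟨w, c⟩ hb
  have hb : w = _ := hb
  subst hb
  exact hP c.1 c.2

/-- The blue edge with a given source. -/
noncomputable def blueAt (n : ℕ) (w : (G.layer n).V1) : (G.layer n).Edge :=
  (G.existsUnique_blue n w).choose

theorem src_blueAt (n : ℕ) (w : (G.layer n).V1) : (G.layer n).src (blueAt n w) = w :=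
  (G.existsUnique_blue n w).choose_spec.1.1

theorem isBlue_blueAt (n : ℕ) (w : (G.layer n).V1) : G.IsBlue n (blueAt n w) :=
  (G.existsUnique_blue n w).choose_spec.1.2

theorem eq_of_isBlue {n : ℕ} {a b : (G.layer n).Edge} (ha : G.IsBlue n a) (hb : G.IsBlue n b)
    (h : (G.layer n).src a = (G.layer n).src b) : a = b :=
  (G.existsUnique_blue n _).unique ⟨h, ha⟩ ⟨rfl, hb⟩

theorem eq_of_not_isBlue {j : ℕ} {a b : (G.layer (2 * j + 1)).Edge}
    (ha : ¬ G.IsBlue (2 * j + 1) a) (hb : ¬ G.IsBlue (2 * j + 1) b)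
    (h : (G.layer (2 * j + 1)).src a = (G.layer (2 * j + 1)).src b) : a = b :=
  (G.existsUnique_red j _).unique ⟨h, ha⟩ ⟨rfl, hb⟩

namespace Path

/-- The source of the `n`-th edge of a path. -/
def node (x : G.Path) (n : ℕ) : (G.layer n).V1 := (G.layer n).src (x.1 n)

theorem ext_node {x y : G.Path} (h : ∀ n, x.node n = y.node n) : x = y :=
  Subtype.ext (funext fun n => eq_of_isBlue (x.2 n).1 (y.2 n).1 (h n))

theorem coe_eq_blueAt (x : G.Path) (n : ℕ) : x.1 n = blueAt n (x.node n) :=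
  eq_of_isBlue (x.2 n).1 (isBlue_blueAt _ _) (src_blueAt _ _).symm

/-- The node in layer `n + 1` determines the blue edge there, whose colour is the previous edge of
the path. Hence a path is determined by its even nodes alone, and likewise by its odd nodes. -/
theorem node_eq_of_succ {x y : G.Path} {n : ℕ} (h : x.node (n + 1) = y.node (n + 1)) :
    x.node n = y.node n := by
  have := eq_of_isBlue (x.2 (n + 1)).1 (y.2 (n + 1)).1 h
  rw [node, node, ← G.col_path x, ← G.col_path y, this]

theorem ext_even {x y : G.Path} (h : ∀ j, x.node (2 * j) = y.node (2 * j)) : x = y := by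
  refine ext_node fun n => ?_
  rcases Nat.even_or_odd' n with ⟨j, rfl | rfl⟩
  · exact h j
  · exact node_eq_of_succ (h (j + 1))

theorem ext_odd {x y : G.Path} (h : ∀ j, x.node (2 * j + 1) = y.node (2 * j + 1)) : x = y := by
  refine ext_node fun n => ?_
  rcases Nat.even_or_odd' n with ⟨j, rfl | rfl⟩
  · exact node_eq_of_succ (h j)
  · exact h j

theorem node_add_two (x : G.Path) (n : ℕ) : (x.node (n + 2)).1 = x.node n := by
  rw [node, ← src_col_col, G.col_path, G.col_path, node]

end Path

/-- A sequence of blue edges that is compatible with the colour maps is a path. -/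
theorem exists_path_of_col (e : ∀ n, (G.layer n).Edge) (hb : ∀ n, G.IsBlue n (e n))
    (hc : ∀ n, (G.layer n).src ((G.layer (n + 1)).col (e (n + 1))) = (G.layer n).src (e n)) :
    ∃ x : G.Path, ∀ n, x.1 n = e n :=
  ⟨⟨e, fun n => ⟨hb n, hc n⟩⟩, fun _ => rfl⟩

theorem exists_path_of_node (w : ∀ n, (G.layer n).V1)
    (hw : ∀ n, (G.layer n).src ((G.layer (n + 1)).col (blueAt (n + 1) (w (n + 1)))) = w n) :
    ∃ x : G.Path, ∀ n, x.node n = w n := by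
  refine ⟨⟨fun n => blueAt n (w n), fun n => ⟨isBlue_blueAt _ _, ?_⟩⟩, fun n => src_blueAt _ _⟩
  exact (hw n).trans (src_blueAt _ _).symm

/-- Every bottom vertex of the layer `1` is a node of a path. -/
theorem exists_path_node_one (w : (G.layer 1).V1) : ∃ x : G.Path, x.node 1 = w := by
  have hext : ∀ n (e : {e : (G.layer (n + 1)).Edge // G.IsBlue (n + 1) e}),
      ∃ a : {e : (G.layer (n + 2)).Edge // G.IsBlue (n + 2) e},
        (G.layer (n + 2)).col a.1 = e.1 := by
    rintro n ⟨e, he⟩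
    obtain ⟨a, ha⟩ := (G.layer (n + 2)).col_surjective e
    refine ⟨⟨a, ?_⟩, ha⟩
    change G.IsBlue (n + 1) ((G.layer (n + 2)).col a)
    rw [ha]
    exact he
  -- The term `s n` lies in layer `n + 1`, and the path consists of the colours of these terms; this
  -- supplies the edge in layer 0 without a separate case.
  obtain ⟨s, h0, hs⟩ := exists_seq_of_forall_exists
    (A := fun n => {e : (G.layer (n + 1)).Edge // G.IsBlue (n + 1) e})
    (fun n e a => (G.layer (n + 2)).col a.1 = e.1) ⟨blueAt 1 w, isBlue_blueAt 1 w⟩ hext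
  obtain ⟨x, hx⟩ := exists_path_of_col (fun n => (G.layer (n + 1)).col (s n).1)
    (fun n => (s n).2) (fun n => congrArg _ (congrArg _ (hs n)))
  refine ⟨x, ?_⟩
  rw [Path.node, hx 1]
  refine (congrArg _ (hs 0)).trans ?_
  rw [h0]
  exact src_blueAt _ _

/-! ### Red threads: injectivity and surjectivity of the shift -/

/-- The sequence of red edges that connects `x` with `σ x`. -/
noncomputable def redThread (x : G.Path) : ∀ n, (G.layer n).Edge := (G.shiftRel_shift x).choose

theorem redThread_spec (x : G.Path) (j : ℕ) :
    (G.IsRomb (2 * j) (x.1 (2 * j)) (redThread x (2 * j)) (x.1 (2 * j + 1))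
        (redThread x (2 * j + 1)) ∧
      (G.layer (2 * j + 1)).col (redThread x (2 * j + 1)) = redThread x (2 * j)) ∧
    G.IsRomb (2 * j + 1) ((G.shift x).1 (2 * j + 1)) (redThread x (2 * j + 1))
      ((G.shift x).1 (2 * j + 2)) (redThread x (2 * j + 2)) :=
  (G.shiftRel_shift x).choose_spec j

theorem not_isBlue_redThread (x : G.Path) (n : ℕ) : ¬ G.IsBlue n (redThread x n) := by
  rcases Nat.even_or_odd' n with ⟨j, rfl | rfl⟩
  · exact (redThread_spec x j).1.1.2.2.1
  · exact (redThread_spec x j).1.1.2.2.2.1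

theorem src_redThread_odd (x : G.Path) (j : ℕ) :
    (G.layer (2 * j + 1)).src (redThread x (2 * j + 1)) = x.node (2 * j + 1) :=
  (redThread_spec x j).1.1.2.2.2.2.2.2.2.symm

/-- Three incidences combine: the red edges of the first romb are consecutive, the two top edges of
the second romb have the same range, and the shifted sequence is a path. -/
theorem src_redThread_even (x : G.Path) (j : ℕ) :
    (G.layer (2 * j)).src (redThread x (2 * j)) = (G.shift x).node (2 * j) :=
  (redThread_spec x j).1.1.2.2.2.2.2.1.symm.trans
    ((redThread_spec x j).2.2.2.2.2.2.2.1.symm.trans ((G.shift x).2 (2 * j)).2)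

/-- The shift relation demands this only for even `n`. For odd `n` both sides are red edges in an
odd layer, so comparing sources suffices; these agree because the thread meets the path again two
layers later. -/
theorem col_redThread (x : G.Path) (n : ℕ) :
    (G.layer (n + 1)).col (redThread x (n + 1)) = redThread x n := by
  rcases Nat.even_or_odd' n with ⟨j, rfl | rfl⟩
  · exact (redThread_spec x j).1.2
  · refine eq_of_not_isBlue (not_isBlue_redThread x (2 * j + 2)) (not_isBlue_redThread x _) ?_
    rw [src_redThread_odd, ← Path.node_add_two]
    have h : (G.layer (2 * j + 3)).src (redThread x (2 * j + 3)) = x.node (2 * j + 3) :=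
      src_redThread_odd x (j + 1)
    rw [← h, ← src_col_col]
    have h : (G.layer (2 * j + 3)).col (redThread x (2 * j + 3)) = redThread x (2 * j + 2) :=
      (redThread_spec x (j + 1)).1.2
    rw [h]

theorem redThread_eq {x : G.Path} {f : ∀ n, (G.layer n).Edge} (hf : ∀ n, ¬ G.IsBlue n (f n))
    (hc : ∀ n, (G.layer (n + 1)).col (f (n + 1)) = f n)
    (ho : ∀ j, (G.layer (2 * j + 1)).src (f (2 * j + 1)) = x.node (2 * j + 1)) (n : ℕ) :
    redThread x n = f n := by
  have h : ∀ j, redThread x (2 * j + 1) = f (2 * j + 1) := fun j =>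
    eq_of_not_isBlue (not_isBlue_redThread x _) (hf _) ((src_redThread_odd x j).trans (ho j).symm)
  rcases Nat.even_or_odd' n with ⟨j, rfl | rfl⟩
  · rw [← col_redThread, h, hc]
  · exact h j

/-- A way to compute the shift without checking rombs: a red sequence compatible with colours and
with the odd nodes of `x` must be its thread, and the even sources of the thread are nodes of the
shift. -/
theorem shift_eq_of_thread {x y : G.Path} {f : ∀ n, (G.layer n).Edge}
    (hf : ∀ n, ¬ G.IsBlue n (f n)) (hc : ∀ n, (G.layer (n + 1)).col (f (n + 1)) = f n)
    (ho : ∀ j, (G.layer (2 * j + 1)).src (f (2 * j + 1)) = x.node (2 * j + 1))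
    (he : ∀ j, (G.layer (2 * j)).src (f (2 * j)) = y.node (2 * j)) :
    G.shift x = y :=
  Path.ext_even fun j => by rw [← src_redThread_even, redThread_eq hf hc ho, he]

/-- The even terms are propagated from `f_0`, since `edge_ext` recovers the term in layer `2j + 2`
from its source, a node of the shift, and the term in layer `2j`. The odd terms are colours of even
ones. -/
theorem redThread_eq_of_shift_eq {x y : G.Path} (h : G.shift x = G.shift y)
    (h0 : redThread x 0 = redThread y 0) (n : ℕ) : redThread x n = redThread y n := by
  have he : ∀ j, redThread x (2 * j) = redThread y (2 * j) := by
    intro j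
    induction j with
    | zero => exact h0
    | succ j ih =>
      refine G.edge_ext (n := 2 * j + 1) ?_ ?_
      · refine (src_redThread_even x (j + 1)).trans ?_
        rw [h]
        exact (src_redThread_even y (j + 1)).symm
      · have hx (z : G.Path) : (G.layer (2 * j + 1)).col ((G.layer (2 * j + 2)).col
            (redThread z (2 * j + 2))) = redThread z (2 * j) := by
          rw [col_redThread, col_redThread]
        exact (hx x).trans (ih.trans (hx y).symm)
  rcases Nat.even_or_odd' n with ⟨j, rfl | rfl⟩
  · exact he j
  · rw [← col_redThread x, ← col_redThread y]
    exact congrArg _ (he (j + 1))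

/-- The shift is injective on the set of paths with a given red edge. -/
theorem eq_of_shift_eq {x y : G.Path} (h : G.shift x = G.shift y)
    (h0 : redThread x 0 = redThread y 0) : x = y :=
  Path.ext_odd fun j => by
    rw [← src_redThread_odd, ← src_redThread_odd, redThread_eq_of_shift_eq h h0]

/-- The propagation that proves injectivity also constructs a preimage: the even red edges are
chosen recursively at the nodes of `y`, the odd ones are their colours, and the preimage is read off
from the sources of the odd ones. -/
theorem exists_shift_eq (y : G.Path) (f : (G.layer 0).Edge) (hf : ¬ G.IsBlue 0 f)
    (hs : (G.layer 0).src f = y.node 0) : ∃ x, G.shift x = y ∧ redThread x 0 = f := by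
  obtain ⟨g, g0, hg⟩ := exists_seq_of_forall_exists
    (A := fun j => {f : (G.layer (2 * j)).Edge // ¬ G.IsBlue (2 * j) f ∧
      (G.layer (2 * j)).src f = y.node (2 * j)})
    (fun j f f' => (G.layer (2 * j + 1)).col ((G.layer (2 * j + 2)).col f'.1) = f.1) ⟨f, hf, hs⟩
    (by
      rintro j ⟨f, hf, hs⟩
      -- The node of `y` in layer `2j + 2` is built from its node in layer `2j`, at which `f`
      -- starts; so it emits an edge lying two layers above `f` in the chain of colours.
      obtain ⟨a, ha, hc⟩ := G.exists_edge (n := 2 * j + 1) (y.node (2 * j + 2)) f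
        (hs.trans (y.node_add_two _).symm)
      refine ⟨⟨a, fun h => hf ?_, ha⟩, hc⟩
      rw [← hc]
      exact h)
  obtain ⟨F, hF0, hF1⟩ := exists_eq_even_odd (F := fun n => (G.layer n).Edge) (fun j => (g j).1)
    (fun j => (G.layer (2 * j + 2)).col (g (j + 1)).1)
  have hFc : ∀ n, (G.layer (n + 1)).col (F (n + 1)) = F n := by
    intro n
    rcases Nat.even_or_odd' n with ⟨j, rfl | rfl⟩
    · rw [hF1, hF0, hg]
    · rw [hF1]
      exact congrArg _ (hF0 (j + 1))
  have hFr : ∀ n, ¬ G.IsBlue n (F n) := by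
    intro n
    rcases Nat.even_or_odd' n with ⟨j, rfl | rfl⟩
    · rw [hF0]
      exact (g j).2.1
    · rw [hF1]
      exact (g (j + 1)).2.1
  -- The path `x` must share its odd nodes with the thread, so its odd edges are the blue edges
  -- there, and its even edges are forced as their colours.
  obtain ⟨E, hE0, hE1⟩ := exists_eq_even_odd (F := fun n => (G.layer n).Edge)
    (fun j => (G.layer (2 * j + 1)).col (blueAt _ ((G.layer (2 * j + 1)).src (F (2 * j + 1)))))
    (fun j => blueAt _ ((G.layer (2 * j + 1)).src (F (2 * j + 1))))
  obtain ⟨x, hx⟩ := exists_path_of_col E (by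
      intro n
      rcases Nat.even_or_odd' n with ⟨j, rfl | rfl⟩
      · rw [hE0]
        exact isBlue_blueAt (2 * j + 1) _
      · rw [hE1]
        exact isBlue_blueAt _ _) (by
      intro n
      rcases Nat.even_or_odd' n with ⟨j, rfl | rfl⟩
      · rw [hE0, hE1]
      · have h : E (2 * j + 2) = (G.layer (2 * j + 3)).col
          (blueAt _ ((G.layer (2 * j + 3)).src (F (2 * j + 3)))) := hE0 (j + 1)
        rw [h, hE1, src_col_col, src_blueAt, src_blueAt, ← src_col_col, hFc, hFc])
  have ho : ∀ j, (G.layer (2 * j + 1)).src (F (2 * j + 1)) = x.node (2 * j + 1) := fun j => by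
    rw [Path.node, hx, hE1, src_blueAt]
  refine ⟨x, shift_eq_of_thread hFr hFc ho fun j => ?_, ?_⟩
  · rw [hF0]
    exact (g j).2.2
  · rw [redThread_eq hFr hFc ho]
    refine (hF0 0).trans ?_
    rw [g0]

end GFSGraph

/-! ### Topology of the path space and its natural structure -/

namespace GFSGraph

variable {G : GFSGraph.{u}}

theorem compactSpace_metrizableSpace_path :
    CompactSpace G.Path ∧ TopologicalSpace.MetrizableSpace G.Path ∧
      TotallyDisconnectedSpace G.Path := by
  let _ : ∀ n, TopologicalSpace (G.layer n).Edge := fun _ => ⊥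
  have : ∀ n, DiscreteTopology (G.layer n).Edge := fun _ => ⟨rfl⟩
  have : ∀ n, Finite (G.layer n).Edge := fun n => (G.layer n).finEdge
  have he : IsEmbedding (fun e : G.Path => e.1) := ⟨⟨rfl⟩, Subtype.val_injective⟩
  have hc : IsClosed (Set.range fun e : G.Path => e.1) := by
    have : (Set.range fun e : G.Path => e.1) = ⋂ n, (fun e : ∀ n, (G.layer n).Edge =>
        (e n, e (n + 1))) ⁻¹' {p | G.IsBlue n p.1 ∧
          (G.layer (n + 1)).rng p.2 = (G.layer n).src p.1} := by
      ext e
      simp only [Set.mem_range, Set.mem_iInter, Set.mem_preimage]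
      exact ⟨fun ⟨x, hx⟩ => hx ▸ x.2, fun h => ⟨⟨e, h⟩, rfl⟩⟩
    rw [this]
    exact isClosed_iInter fun n => (isClosed_discrete _).preimage
      ((continuous_apply n).prodMk (continuous_apply (n + 1)))
  have hce : IsClosedEmbedding (fun e : G.Path => e.1) := ⟨he, hc⟩
  have h1 : CompactSpace G.Path := hce.compactSpace
  have h2 : T2Space G.Path := he.t2Space
  have h3 : SecondCountableTopology G.Path := he.secondCountableTopology
  exact ⟨h1, inferInstance, ⟨(he.isTotallyDisconnected_image).1
    (isTotallyDisconnected_of_totallyDisconnectedSpace _)⟩⟩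

theorem continuous_path_iff {Y : Type*} [TopologicalSpace Y] {φ : Y → G.Path} :
    Continuous φ ↔ ∀ n, IsLocallyConstant fun y => (φ y).1 n := by
  let _ : ∀ n, TopologicalSpace (G.layer n).Edge := fun _ => ⊥
  have : ∀ n, DiscreteTopology (G.layer n).Edge := fun _ => ⟨rfl⟩
  rw [continuous_induced_rng, continuous_pi_iff]
  exact forall_congr' fun n => (IsLocallyConstant.iff_continuous _).symm

theorem Path.isLocallyConstant_coe (n : ℕ) : IsLocallyConstant fun x : G.Path => x.1 n :=
  continuous_path_iff.1 continuous_id n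

theorem Path.isLocallyConstant_node (n : ℕ) : IsLocallyConstant fun x : G.Path => x.node n :=
  (Path.isLocallyConstant_coe n).comp (G.layer n).src

theorem continuous_of_node {Y : Type*} [TopologicalSpace Y] {φ : Y → G.Path}
    (h : ∀ n, IsLocallyConstant fun y => (φ y).node n) : Continuous φ := by
  refine continuous_path_iff.2 fun n => ?_
  simp only [Path.coe_eq_blueAt]
  exact (h n).comp (blueAt n)

theorem continuous_of_node_even {Y : Type*} [TopologicalSpace Y] {φ : Y → G.Path}
    (h : ∀ j, IsLocallyConstant fun y => (φ y).node (2 * j)) : Continuous φ := by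
  refine continuous_of_node fun n => ?_
  rcases Nat.even_or_odd' n with ⟨j, rfl | rfl⟩
  · exact h j
  · refine (IsLocallyConstant.iff_eventually_eq _).2 fun y => ?_
    filter_upwards [(IsLocallyConstant.iff_eventually_eq _).1 (h (j + 1)) y] with z hz
    exact Path.node_eq_of_succ hz

/-- An odd term depends only on one node of the path, by uniqueness of red edges in odd layers; an
even term is the colour of an odd one. -/
theorem isLocallyConstant_redThread (n : ℕ) :
    IsLocallyConstant fun x : G.Path => redThread x n := by
  have h : ∀ j, IsLocallyConstant fun x : G.Path => redThread x (2 * j + 1) := by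
    intro j
    refine (IsLocallyConstant.iff_eventually_eq _).2 fun y => ?_
    filter_upwards [(IsLocallyConstant.iff_eventually_eq _).1
      (Path.isLocallyConstant_node (2 * j + 1)) y] with z hz
    exact eq_of_not_isBlue (not_isBlue_redThread _ _) (not_isBlue_redThread _ _)
      ((src_redThread_odd z j).trans (hz.trans (src_redThread_odd y j).symm))
  rcases Nat.even_or_odd' n with ⟨j, rfl | rfl⟩
  · have hE : (fun x : G.Path => redThread x (2 * j)) =
        (G.layer (2 * j + 1)).col ∘ fun x => redThread x (2 * j + 1) :=
      funext fun x => (col_redThread x _).symm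
    rw [hE]
    exact (h j).comp _
  · exact h j

theorem continuous_shift : Continuous G.shift := by
  refine continuous_of_node_even fun j => ?_
  simp only [← src_redThread_even]
  exact (isLocallyConstant_redThread _).comp _

/-- In layer 1 there is only one red edge at the node of `x`, so the romb in the definition of
`cylRed` must be the one used by the shift. -/
theorem mem_cylRed {f : G.R} {x : G.Path} :
    x ∈ G.cylRed f ↔ redThread x 0 = (Sum.inr f : G.B ⊕ G.R) := by
  constructor
  · rintro ⟨a, h, hc⟩
    have : redThread x 1 = a := eq_of_not_isBlue (j := 0) (not_isBlue_redThread x 1) h.2.2.2.1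
      ((src_redThread_odd x 0).trans h.2.2.2.2.2.2.2)
    rw [← col_redThread, this, hc]
  · intro h
    have := (redThread_spec x 0).1
    refine ⟨redThread x 1, ?_, ?_⟩
    · rw [← h]
      exact this.1
    · rw [← h]
      exact this.2

theorem mem_cylBlue {e : G.B} {x : G.Path} : x ∈ G.cylBlue e ↔ x.node 0 = G.sB e := by
  constructor
  · intro h
    have h : x.1 0 = _ := h
    rw [Path.node, h]
    rfl
  · exact fun h => eq_of_isBlue (n := 0) (a := x.1 0) (b := (Sum.inl e : G.B ⊕ G.R)) (x.2 0).1
      rfl h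

theorem exists_mem_cylBlue (x : G.Path) : ∃ e, x ∈ G.cylBlue e := by
  obtain ⟨e, he⟩ := G.sB_bijective.2 (x.node 0)
  exact ⟨e, mem_cylBlue.2 he.symm⟩

theorem exists_mem_cylRed (x : G.Path) : ∃ f, x ∈ G.cylRed f := by
  have h := not_isBlue_redThread x 0
  rcases hx : (redThread x 0 : G.B ⊕ G.R) with e | f
  · rw [hx] at h
    exact absurd rfl h
  · exact ⟨f, mem_cylRed.2 hx⟩

theorem rB_eq_rR {x : G.Path} {e : G.B} {f : G.R} (he : x ∈ G.cylBlue e) (hf : x ∈ G.cylRed f) :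
    G.rB e = G.rR f := by
  have h := (redThread_spec x 0).1.1.2.2.2.2.2.2.1
  have h1 : x.1 (2 * 0) = (Sum.inl e : G.B ⊕ G.R) := he
  have h2 : redThread x (2 * 0) = (Sum.inr f : G.B ⊕ G.R) := mem_cylRed.1 hf
  rw [h1, h2] at h
  exact h

theorem isClopen_cylBlue (e : G.B) : IsClopen (G.cylBlue e) :=
  (Path.isLocallyConstant_coe 0).isClopen_fiber (Sum.inl e : G.B ⊕ G.R)

theorem isClopen_cylRed (f : G.R) : IsClopen (G.cylRed f) := by
  have : G.cylRed f = {x | redThread x 0 = (Sum.inr f : G.B ⊕ G.R)} := Set.ext fun x => mem_cylRed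
  rw [this]
  exact (isLocallyConstant_redThread 0).isClopen_fiber _

theorem nonempty_cylBlue (e : G.B) : (G.cylBlue e).Nonempty := by
  obtain ⟨a, ha⟩ := (G.layer 1).col_surjective (Sum.inl e : G.B ⊕ G.R)
  obtain ⟨x, hx⟩ := exists_path_node_one ((G.layer 1).src a)
  refine ⟨x, ?_⟩
  have hb : G.IsBlue 1 a := by
    change G.IsBlue 0 ((G.layer 1).col a)
    rw [ha]
    rfl
  have : x.1 1 = a := eq_of_isBlue (x.2 1).1 hb hx
  change x.1 0 = _
  rw [← G.col_path, this, ha]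

/-- Some edge of layer 1 has colour `f`; a path through its source has this edge in its red thread.
-/
theorem nonempty_cylRed (f : G.R) : (G.cylRed f).Nonempty := by
  obtain ⟨a, ha⟩ := (G.layer 1).col_surjective (Sum.inr f : G.B ⊕ G.R)
  obtain ⟨x, hx⟩ := exists_path_node_one ((G.layer 1).src a)
  refine ⟨x, mem_cylRed.2 ?_⟩
  have hb : ¬ G.IsBlue 1 a := by
    change ¬ G.IsBlue 0 ((G.layer 1).col a)
    rw [ha]
    exact fun h => by cases h
  have : redThread x 1 = a := eq_of_not_isBlue (j := 0) (not_isBlue_redThread x 1) hb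
    ((src_redThread_odd x 0).trans hx)
  rw [← col_redThread, this, ha]

/-- The natural `(E, C)`-structure on the generalized finite shift. -/
def shiftStructure (G : GFSGraph.{u}) : ECStructure G G.shift where
  Z := G.cylBlue
  W := G.cylRed
  isOpen_Z e := (isClopen_cylBlue e).isOpen
  isCompact_Z e := by
    have := compactSpace_metrizableSpace_path (G := G).1
    exact (isClopen_cylBlue e).isClosed.isCompact
  nonempty_Z := nonempty_cylBlue
  isOpen_W f := (isClopen_cylRed f).isOpen
  isCompact_W f := by
    have := compactSpace_metrizableSpace_path (G := G).1
    exact (isClopen_cylRed f).isClosed.isCompact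
  nonempty_W := nonempty_cylRed
  disjoint_Z e e' h := Set.disjoint_left.2 fun x h1 h2 => h (G.sB_bijective.1
    ((mem_cylBlue.1 h1).symm.trans (mem_cylBlue.1 h2)))
  iUnion_Z := Set.iUnion_eq_univ_iff.2 exists_mem_cylBlue
  disjoint_W f f' h := Set.disjoint_left.2 fun x h1 h2 => h (Sum.inr_injective
    ((mem_cylRed.1 h1).symm.trans (mem_cylRed.1 h2)))
  union_eq v := by
    ext x
    obtain ⟨e, he⟩ := exists_mem_cylBlue x
    obtain ⟨f, hf⟩ := exists_mem_cylRed x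
    simp only [Set.mem_iUnion, Set.mem_ofPred_eq]
    constructor
    · rintro ⟨e', h1, h2⟩
      exact ⟨f, (rB_eq_rR h2 hf).symm.trans h1, hf⟩
    · rintro ⟨f', h1, h2⟩
      exact ⟨e, (rB_eq_rR he h2).trans h1, he⟩
  injOn f x hx y hy h := eq_of_shift_eq h ((mem_cylRed.1 hx).trans (mem_cylRed.1 hy).symm)
  image_eq e f h := by
    ext y
    constructor
    · rintro ⟨x, hx, rfl⟩
      have h1 := src_redThread_even x 0
      have h2 : redThread x (2 * 0) = _ := mem_cylRed.1 hx
      rw [h2] at h1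
      exact mem_cylBlue.2 (h1.symm.trans h.symm)
    · intro hy
      obtain ⟨x, hx, h0⟩ := exists_shift_eq y (Sum.inr f : G.B ⊕ G.R) (fun h => by cases h)
        (h.symm.trans (mem_cylBlue.1 hy).symm)
      exact ⟨x, mem_cylRed.2 h0, hx⟩

end GFSGraph

/-! ### Dynamics forced by an `(E, C)`-structure -/

namespace ECStructure

variable {G : GFSGraph.{u}} {Y : Type v} [TopologicalSpace Y] {ρ : Y → Y}

theorem exists_mem_Z (S : ECStructure G ρ) (y : Y) : ∃ e, y ∈ S.Z e := by
  have : y ∈ ⋃ e, S.Z e := S.iUnion_Z ▸ Set.mem_univ y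
  exact Set.mem_iUnion.1 this

theorem eq_of_mem_Z (S : ECStructure G ρ) {y : Y} {e e' : G.B} (h : y ∈ S.Z e)
    (h' : y ∈ S.Z e') : e = e' := by
  by_contra hne
  exact Set.disjoint_left.1 (S.disjoint_Z _ _ hne) h h'

theorem eq_of_mem_W (S : ECStructure G ρ) {y : Y} {f f' : G.R} (h : y ∈ S.W f)
    (h' : y ∈ S.W f') : f = f' := by
  by_contra hne
  exact Set.disjoint_left.1 (S.disjoint_W _ _ hne) h h'

theorem exists_mem_W (S : ECStructure G ρ) {y : Y} {e : G.B} (h : y ∈ S.Z e) :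
    ∃ f, G.rR f = G.rB e ∧ y ∈ S.W f := by
  have : y ∈ ⋃ e' ∈ {e' | G.rB e' = G.rB e}, S.Z e' := Set.mem_biUnion rfl h
  rw [S.union_eq] at this
  simpa using this

theorem rB_eq_rR (S : ECStructure G ρ) {y : Y} {e : G.B} {f : G.R} (he : y ∈ S.Z e)
    (hf : y ∈ S.W f) : G.rB e = G.rR f := by
  obtain ⟨f', h, hf'⟩ := S.exists_mem_W he
  rw [← h, S.eq_of_mem_W hf hf']

theorem surjective (S : ECStructure G ρ) : Function.Surjective ρ := by
  intro y
  obtain ⟨e, he⟩ := S.exists_mem_Z y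
  obtain ⟨f, hf⟩ := G.sR_surjective (G.sB e)
  rw [← S.image_eq e f hf.symm] at he
  obtain ⟨x, -, hx⟩ := he
  exact ⟨x, hx⟩

/-- Injectivity on `W f` turns the image of `U` into the open set `Z e` minus the image of the
compact set `W f \ U`, which is closed. -/
theorem isOpen_image (S : ECStructure G ρ) (hρ : Continuous ρ) [T2Space Y] (f : G.R)
    {U : Set Y} (hU : IsOpen U) (h : U ⊆ S.W f) : IsOpen (ρ '' U) := by
  obtain ⟨e, he⟩ := G.sB_bijective.2 (G.sR f)
  have : ρ '' U = S.Z e \ ρ '' (S.W f \ U) := by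
    rw [← S.image_eq e f he, (S.injOn f).image_sdiff, Set.inter_eq_self_of_subset_right h,
      Set.sdiff_sdiff_cancel_left (Set.image_mono h)]
  rw [this]
  exact (S.isOpen_Z e).sdiff (((S.isCompact_W f).diff hU).image hρ).isClosed

theorem isLocalHomeomorph (S : ECStructure G ρ) (hρ : Continuous ρ) [T2Space Y] :
    IsLocalHomeomorph ρ := by
  refine isLocalHomeomorph_iff_isOpenEmbedding_restrict.2 fun y => ?_
  obtain ⟨e, he⟩ := S.exists_mem_Z y
  obtain ⟨f, -, hf⟩ := S.exists_mem_W he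
  refine ⟨S.W f, (S.isOpen_W f).mem_nhds hf, .of_continuous_injective_isOpenMap
    (hρ.comp continuous_subtype_val) (S.injOn f).injective fun U hU => ?_⟩
  have := S.isOpen_image hρ f (((S.isOpen_W f).isOpenEmbedding_subtypeVal).isOpenMap U hU)
    (by rintro _ ⟨x, -, rfl⟩; exact x.2)
  rwa [Set.image_image] at this

end ECStructure

theorem GFSGraph.isLHomeo_shift (G : GFSGraph.{u}) : IsLHomeo G.shift := by
  obtain ⟨h1, h2, h3⟩ := GFSGraph.compactSpace_metrizableSpace_path (G := G)
  exact ⟨h1, h2, h3, G.shiftStructure.surjective,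
    G.shiftStructure.isLocalHomeomorph GFSGraph.continuous_shift⟩

/-! ### Roots of edges -/

namespace GFSGraph

variable {G : GFSGraph.{u}}

/-- The edge of the original graph from which an edge of a resolution descends. -/
def root : (n : ℕ) → (G.layer n).Edge → G.B ⊕ G.R
  | 0 => fun e => e
  | n + 1 => fun a => root n ((G.layer (n + 1)).col a)

theorem isBlue_iff_root (n : ℕ) (x : (G.layer n).Edge) :
    G.IsBlue n x ↔ (root n x).isLeft = true := by
  induction n with
  | zero => exact Iff.rfl
  | succ n ih => exact ih _

/-- A red edge in an even layer that ends on the path `σ x` and has the same root as the red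
thread of `x` belongs to this thread. -/
theorem eq_redThread_of_root {x : G.Path} (j : ℕ) (b : (G.layer (2 * j)).Edge)
    (hb : (G.layer (2 * j)).src b = (G.shift x).node (2 * j))
    (hr : root (2 * j) b = root 0 (redThread x 0)) : b = redThread x (2 * j) := by
  induction j with
  | zero => exact hr
  | succ j ih =>
    refine G.edge_ext (n := 2 * j + 1) (hb.trans (src_redThread_even x (j + 1)).symm) ?_
    have h1 : (G.layer (2 * j + 1)).col ((G.layer (2 * j + 2)).col b) = redThread x (2 * j) := by
      refine ih _ ?_ hr
      rw [src_col_col, ← Path.node_add_two]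
      exact congrArg Sigma.fst hb
    have h2 : (G.layer (2 * j + 1)).col ((G.layer (2 * j + 2)).col (redThread x (2 * j + 2))) =
        redThread x (2 * j) := by
      rw [col_redThread, col_redThread]
    exact h1.trans h2.symm

end GFSGraph

/-! ### Partial homeomorphisms attached to edges, and codings of `Y` -/

namespace ECStructure

variable {G : GFSGraph.{u}} {Y : Type v} [TopologicalSpace Y] {ρ : Y → Y}

/-- The inverse of the restriction of `ρ` to `W f`. -/
noncomputable def branch (S : ECStructure G ρ) (f : G.R) : Y → Y :=
  haveI : Nonempty Y := ⟨(S.nonempty_W f).some⟩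
  Function.invFunOn ρ (S.W f)

theorem branch_mem (S : ECStructure G ρ) {f : G.R} {y : Y} (h : y ∈ ρ '' S.W f) :
    S.branch f y ∈ S.W f :=
  haveI : Nonempty Y := ⟨(S.nonempty_W f).some⟩
  Function.invFunOn_mem h

theorem apply_branch (S : ECStructure G ρ) {f : G.R} {y : Y} (h : y ∈ ρ '' S.W f) :
    ρ (S.branch f y) = y :=
  haveI : Nonempty Y := ⟨(S.nonempty_W f).some⟩
  Function.invFunOn_eq h

theorem branch_apply (S : ECStructure G ρ) {f : G.R} {y : Y} (h : y ∈ S.W f) :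
    S.branch f (ρ y) = y :=
  S.injOn f (S.branch_mem ⟨y, h, rfl⟩) h (S.apply_branch ⟨y, h, rfl⟩)

theorem continuousAt_branch (S : ECStructure G ρ) (hρ : IsOpenMap ρ) {f : G.R} {y : Y}
    (h : y ∈ ρ '' S.W f) : ContinuousAt (S.branch f) y := by
  refine continuousAt_def.2 fun A hA => ?_
  obtain ⟨U, hUA, hU, hy⟩ := mem_nhds_iff.1 hA
  refine Filter.mem_of_superset ((hρ _ (hU.inter (S.isOpen_W f))).mem_nhds
    ⟨_, ⟨hy, S.branch_mem h⟩, S.apply_branch h⟩) ?_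
  rintro _ ⟨x, ⟨hx, hxW⟩, rfl⟩
  rw [Set.mem_preimage, S.branch_apply hxW]
  exact hUA hx

/-- The partial homeomorphism attached to an edge with root `r` in layer `n`, extended to `Y`. -/
noncomputable def transfer (S : ECStructure G ρ) (n : ℕ) : G.B ⊕ G.R → Y → Y
  | Sum.inl _ => id
  | Sum.inr f => open Classical in if Even n then S.branch f else ρ

/-- The domain of `transfer`. -/
def transferDom (S : ECStructure G ρ) (n : ℕ) : G.B ⊕ G.R → Set Y
  | Sum.inl _ => Set.univ
  | Sum.inr f => {y | (Even n → y ∈ ρ '' S.W f) ∧ (¬ Even n → y ∈ S.W f)}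

theorem transfer_inr_even (S : ECStructure G ρ) {n : ℕ} (h : Even n) (f : G.R) :
    S.transfer n (Sum.inr f) = S.branch f := if_pos h

theorem transfer_inr_odd (S : ECStructure G ρ) {n : ℕ} (h : ¬ Even n) (f : G.R) :
    S.transfer n (Sum.inr f) = ρ := if_neg h

theorem transfer_of_isBlue (S : ECStructure G ρ) {n : ℕ} {x : (G.layer n).Edge}
    (h : G.IsBlue n x) (y : Y) : S.transfer n (root n x) y = y := by
  rw [isBlue_iff_root] at h
  rcases hr : root n x with e | f
  · rfl
  · rw [hr] at h
    cases h

theorem transfer_of_odd (S : ECStructure G ρ) {n : ℕ} (hn : ¬ Even n) {x : (G.layer n).Edge}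
    (h : ¬ G.IsBlue n x) (y : Y) : S.transfer n (root n x) y = ρ y := by
  rw [isBlue_iff_root] at h
  rcases hr : root n x with e | f
  · rw [hr] at h
    exact absurd rfl h
  · rw [S.transfer_inr_odd hn]

theorem transfer_add_two (S : ECStructure G ρ) (n : ℕ) (r : G.B ⊕ G.R) :
    S.transfer (n + 2) r = S.transfer n r := by
  rcases r with e | f
  · rfl
  · by_cases h : Even n
    · rw [S.transfer_inr_even h, S.transfer_inr_even (h.add even_two)]
    · rw [S.transfer_inr_odd h, S.transfer_inr_odd (by simpa [parity_simps] using h)]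

theorem transferDom_add_two (S : ECStructure G ρ) (n : ℕ) (r : G.B ⊕ G.R) :
    S.transferDom (n + 2) r = S.transferDom n r := by
  rcases r with e | f
  · rfl
  · simp [transferDom, parity_simps]

/-- Passing to the next layer changes parity, which exchanges `ρ` and its inverse branch on `W f`.
So an edge and its colour, having the same root, act by mutually inverse partial maps. -/
theorem transfer_transfer_succ (S : ECStructure G ρ) {n : ℕ} {r : G.B ⊕ G.R} {y : Y}
    (h : y ∈ S.transferDom (n + 1) r) : S.transfer n r (S.transfer (n + 1) r y) = y := by
  rcases r with e | f
  · rfl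
  · by_cases hn : Even n
    · have h' : ¬ Even (n + 1) := by simpa [parity_simps] using hn
      rw [S.transfer_inr_even hn, S.transfer_inr_odd h']
      exact S.branch_apply (h.2 h')
    · have h' : Even (n + 1) := by simpa [parity_simps] using hn
      rw [S.transfer_inr_odd hn, S.transfer_inr_even h']
      exact S.apply_branch (h.1 h')

theorem continuousAt_transfer (S : ECStructure G ρ) (hρ : IsLocalHomeomorph ρ) {n : ℕ}
    {r : G.B ⊕ G.R} {y : Y} (h : y ∈ S.transferDom n r) : ContinuousAt (S.transfer n r) y := by
  rcases r with e | f
  · exact continuousAt_id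
  · by_cases hn : Even n
    · rw [S.transfer_inr_even hn]
      exact S.continuousAt_branch hρ.isOpenMap (h.1 hn)
    · rw [S.transfer_inr_odd hn]
      exact hρ.continuous.continuousAt

/-- `p` and `q` record the cells of `Y` in the layers `n` and `n + 1`. -/
structure IsCoding (S : ECStructure G ρ) (n : ℕ) (p : Y → (G.layer n).V1)
    (q : Y → (G.layer (n + 1)).V1) : Prop where
  mem_dom : ∀ y x, (G.layer n).src x = p y → y ∈ S.transferDom n (root n x)
  mem_dom_succ : ∀ y a, (G.layer (n + 1)).src a = q y →
    y ∈ S.transferDom (n + 1) (root (n + 1) a)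
  exists_edge : ∀ y x, (G.layer n).src x = p y → ∃ a,
    (G.layer (n + 1)).src a = q (S.transfer n (root n x) y) ∧ (G.layer (n + 1)).col a = x
  src_col : ∀ y a, (G.layer (n + 1)).src a = q y →
    p (S.transfer (n + 1) (root (n + 1) a) y) = (G.layer n).src ((G.layer (n + 1)).col a)

/-- The new vertex at `y` must select one edge of each colour `x` with source `p y`. The selection
is the edge of colour `x` starting at the cell of the point to which `x` transfers `y`; the field
`exists_edge` says that there is one. -/
theorem IsCoding.exists_succ {S : ECStructure G ρ} {n : ℕ} {p : Y → (G.layer n).V1}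
    {q : Y → (G.layer (n + 1)).V1} (h : S.IsCoding n p q) :
    ∃ r : Y → (G.layer (n + 2)).V1, S.IsCoding (n + 1) q r ∧ (∀ y, (r y).1 = p y) ∧
      ∀ y b, (G.layer (n + 2)).src b = r y → (G.layer (n + 1)).src ((G.layer (n + 2)).col b) =
        q (S.transfer n (root (n + 2) b) y) := by
  have hex : ∀ y, ∃ w : (G.layer (n + 2)).V1, w.1 = p y ∧
      ∀ b, (G.layer (n + 2)).src b = w → (G.layer (n + 1)).src ((G.layer (n + 2)).col b) =
        q (S.transfer n (root (n + 2) b) y) := by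
    intro y
    refine exists_vertex (n := n + 1) (p y) (fun a => (G.layer (n + 1)).src a =
      q (S.transfer n (root (n + 1) a) y)) fun x hx => ?_
    obtain ⟨a, ha, rfl⟩ := h.exists_edge y x hx
    exact ⟨a, rfl, ha⟩
  choose r hr1 hr2 using hex
  refine ⟨r, ⟨h.mem_dom_succ, fun y b hb => ?_, fun y a ha => ?_, fun y b hb => ?_⟩, hr1, hr2⟩
  · rw [S.transferDom_add_two]
    refine h.mem_dom y ((G.layer (n + 1)).col ((G.layer (n + 2)).col b)) ?_
    rw [src_col_col, ← hr1]
    exact congrArg Sigma.fst hb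
  -- The new vertex at the transferred point `z` selects an edge of the same colour as `a`. Its
  -- source is the cell of `z` transferred back, which is `y`, so by `edge_ext` it is `a` itself.
  · set z := S.transfer (n + 1) (root (n + 1) a) y with hz
    have hzy : S.transfer n (root (n + 1) a) z = y :=
      S.transfer_transfer_succ (h.mem_dom_succ y a ha)
    obtain ⟨b, hb, hc⟩ := G.exists_edge (n := n + 1) (r z) ((G.layer (n + 1)).col a)
      ((h.src_col y a ha).symm.trans (hr1 z).symm)
    refine ⟨b, hb, G.edge_ext (n := n) ?_ (congrArg _ hc)⟩
    rw [hr2 z b hb, ha]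
    have : root (n + 2) b = root (n + 1) a := congrArg (root n) hc
    rw [this, hzy]
  · rw [S.transfer_add_two, hr2 y b hb]

/-- The cell of an edge of the graph. -/
def cell (S : ECStructure G ρ) (x : (G.layer 0).Edge) : Set Y :=
  Sum.elim S.Z S.W (x : G.B ⊕ G.R)

theorem eq_of_mem_cell (S : ECStructure G ρ) {y : Y} {x x' : (G.layer 0).Edge}
    (h : y ∈ S.cell x) (h' : y ∈ S.cell x') (hc : (G.layer 0).col x = (G.layer 0).col x') :
    x = x' := by
  rcases x with e | f <;> rcases x' with e' | f'
  · exact congrArg Sum.inl (S.eq_of_mem_Z h h')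
  · cases hc
  · cases hc
  · exact congrArg Sum.inr (S.eq_of_mem_W h h')

theorem rng_eq_of_mem_cell (S : ECStructure G ρ) {y : Y} {x : (G.layer 0).Edge} {e : G.B}
    (h : y ∈ S.cell x) (he : y ∈ S.Z e) : (G.layer 0).rng x = G.rB e := by
  rcases x with e' | f
  · rw [S.eq_of_mem_Z he h]
    rfl
  · exact (S.rB_eq_rR he h).symm

theorem exists_mem_cell (S : ECStructure G ρ) {y : Y} {e : G.B} (he : y ∈ S.Z e)
    (c : (G.layer 0).Col) (hc : (G.layer 0).vert c = G.rB e) :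
    ∃ x, (G.layer 0).col x = c ∧ y ∈ S.cell x := by
  rcases c with c | c
  · exact ⟨Sum.inl e, congrArg Sum.inl hc.symm, he⟩
  · obtain ⟨f, hf, hy⟩ := S.exists_mem_W he
    exact ⟨Sum.inr f, congrArg Sum.inr (hf.trans hc.symm), hy⟩

/-- In layer 0 the cell is the source of the blue edge whose set contains `y`. In layer 1 it is the
pair consisting of the blue and the red edge whose sets contain `y`. -/
theorem exists_isCoding_zero (S : ECStructure G ρ) :
    ∃ (p : Y → (G.layer 0).V1) (q : Y → (G.layer 1).V1), S.IsCoding 0 p q ∧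
      (∀ y e, y ∈ S.Z e → p y = G.sB e) ∧
      ∀ y a, (G.layer 1).src a = q y → y ∈ S.cell ((G.layer 1).col a) := by
  choose z hz using S.exists_mem_Z
  have hex : ∀ y, ∃ w : (G.layer 1).V1, w.1 = G.rB (z y) ∧
      ∀ b, (G.layer 1).src b = w → y ∈ S.cell ((G.layer 1).col b) := fun y =>
    exists_vertex (n := 0) (G.rB (z y)) (fun x => y ∈ S.cell x) (S.exists_mem_cell (hz y))
  choose q hq1 hq2 using hex
  have hp : ∀ y e, y ∈ S.Z e → G.sB (z y) = G.sB e := fun y e he => by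
    rw [S.eq_of_mem_Z he (hz y)]
  have hedge : ∀ y x, y ∈ S.cell x → ∃ a, (G.layer 1).src a = q y ∧ (G.layer 1).col a = x := by
    intro y x hx
    obtain ⟨a, ha, hc⟩ := G.exists_edge (n := 0) (q y) ((G.layer 0).col x)
      ((S.rng_eq_of_mem_cell hx (hz y)).trans (hq1 y).symm)
    exact ⟨a, ha, S.eq_of_mem_cell (hq2 y a ha) hx hc⟩
  have hR : ∀ y f, G.sR f = G.sB (z y) → y ∈ ρ '' S.W f := fun y f h => by
    rw [S.image_eq _ _ h.symm]
    exact hz y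
  refine ⟨fun y => G.sB (z y), q, ⟨?_, ?_, ?_, ?_⟩, hp, hq2⟩
  · rintro y (e | f) hx
    · trivial
    · exact ⟨fun _ => hR y f hx, fun h => absurd Even.zero h⟩
  · intro y a ha
    have hy := hq2 y a ha
    change y ∈ S.transferDom 1 ((G.layer 1).col a)
    generalize (G.layer 1).col a = x at hy ⊢
    rcases x with e | f
    · trivial
    · exact ⟨fun h => absurd h (by decide), fun _ => hy⟩
  · rintro y (e | f) hx
    · refine hedge _ _ ?_
      have : e = z y := G.sB_bijective.1 hx
      rw [this]
      exact hz y
    · refine hedge _ _ ?_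
      change S.transfer 0 (Sum.inr f) y ∈ S.W f
      rw [S.transfer_inr_even Even.zero]
      exact S.branch_mem (hR y f hx)
  · intro y a ha
    have hy := hq2 y a ha
    change G.sB (z (S.transfer 1 ((G.layer 1).col a) y)) = _
    rcases hc : (G.layer 1).col a with e | f
    · rw [hc] at hy
      exact hp y e hy
    · rw [hc] at hy
      rw [S.transfer_inr_odd (by decide)]
      obtain ⟨e, he⟩ := G.sB_bijective.2 (G.sR f)
      rw [hp (ρ y) e (S.image_eq e f he ▸ ⟨y, hy, rfl⟩), he]
      rfl

/-- The system of codings of all layers. -/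
theorem exists_coding (S : ECStructure G ρ) :
    ∃ p : ∀ n, Y → (G.layer n).V1, (∀ n, S.IsCoding n (p n) (p (n + 1))) ∧
      (∀ y e, y ∈ S.Z e → p 0 y = G.sB e) ∧
      (∀ y a, (G.layer 1).src a = p 1 y → y ∈ S.cell ((G.layer 1).col a)) ∧
      (∀ n y, (p (n + 2) y).1 = p n y) ∧
      ∀ n y b, (G.layer (n + 2)).src b = p (n + 2) y →
        (G.layer (n + 1)).src ((G.layer (n + 2)).col b) =
          p (n + 1) (S.transfer n (root (n + 2) b) y) := by
  obtain ⟨p, q, hpq, h0, h1⟩ := S.exists_isCoding_zero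
  -- The recursion uses two layers at a time, so the objects chosen are pairs of consecutive
  -- codings, and successive pairs overlap in one layer.
  obtain ⟨s, hs0, hs⟩ := exists_seq_of_forall_exists
    (A := fun n => {c : (Y → (G.layer n).V1) × (Y → (G.layer (n + 1)).V1) //
      S.IsCoding n c.1 c.2})
    (fun n c d => d.1.1 = c.1.2 ∧ (∀ y, (d.1.2 y).1 = c.1.1 y) ∧
      ∀ y b, (G.layer (n + 2)).src b = d.1.2 y →
        (G.layer (n + 1)).src ((G.layer (n + 2)).col b) =
          c.1.2 (S.transfer n (root (n + 2) b) y)) ⟨(p, q), hpq⟩ (by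
      rintro n ⟨⟨p, q⟩, h⟩
      obtain ⟨r, hr, hr1, hr2⟩ := h.exists_succ
      exact ⟨⟨(q, r), hr⟩, rfl, hr1, hr2⟩)
  have hsucc : ∀ n, (s (n + 1)).1.1 = (s n).1.2 := fun n => (hs n).1
  refine ⟨fun n => (s n).1.1, fun n => ?_, ?_, ?_, fun n y => ?_, fun n y => ?_⟩
  · dsimp only
    rw [hsucc]
    exact (s n).2
  · dsimp only
    rw [hs0]
    exact h0
  · dsimp only
    rw [hsucc, hs0]
    exact h1
  · dsimp only
    rw [hsucc (n + 1)]
    exact (hs n).2.1 y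
  · dsimp only
    rw [hsucc (n + 1), hsucc n]
    exact (hs n).2.2 y

end ECStructure

/-! ### Nodes of the first resolution and cells -/

namespace GFSGraph

variable {G : GFSGraph.{u}}

/-- The node in layer 1 emits exactly one blue and one red edge, namely the edge of the path and the
term of the red thread; their colours are the initial edges defining the cylinders that contain `x`.
-/
theorem mem_cell_of_src_eq_node {x : G.Path} {b : (G.layer 1).Edge}
    (hb : (G.layer 1).src b = x.node 1) : x ∈ G.shiftStructure.cell ((G.layer 1).col b) := by
  by_cases h : G.IsBlue 1 b
  · obtain ⟨e, he⟩ := exists_mem_cylBlue x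
    have hc : (G.layer 1).col b = (Sum.inl e : G.B ⊕ G.R) := by
      rw [eq_of_isBlue h (x.2 1).1 hb, G.col_path]
      exact he
    rw [hc]
    exact he
  · obtain ⟨f, hf⟩ := exists_mem_cylRed x
    have hc : (G.layer 1).col b = (Sum.inr f : G.B ⊕ G.R) := by
      rw [eq_of_not_isBlue (j := 0) h (not_isBlue_redThread x 1)
        (hb.trans (src_redThread_odd x 0).symm), col_redThread]
      exact mem_cylRed.1 hf
    rw [hc]
    exact hf

end GFSGraph

/-! ### The unique equivariant map to the shift space -/

namespace ECStructure

variable {G : GFSGraph.{u}} {Y : Type v} [TopologicalSpace Y] {ρ : Y → Y}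

theorem isOpen_cell (S : ECStructure G ρ) (x : (G.layer 0).Edge) : IsOpen (S.cell x) := by
  rcases x with e | f
  · exact S.isOpen_Z e
  · exact S.isOpen_W f

/-- A vertex of the first resolution is determined by a point in the cells it selects. -/
theorem vertex_ext_cell (S : ECStructure G ρ) {y : Y} {w w' : (G.layer 1).V1}
    (h : ∀ a, (G.layer 1).src a = w → y ∈ S.cell ((G.layer 1).col a))
    (h' : ∀ a, (G.layer 1).src a = w' → y ∈ S.cell ((G.layer 1).col a)) : w = w' := by
  obtain ⟨e, he⟩ := S.exists_mem_Z y
  have hfst : ∀ w : (G.layer 1).V1,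
      (∀ a, (G.layer 1).src a = w → y ∈ S.cell ((G.layer 1).col a)) → w.1 = G.rB e := by
    intro w h
    obtain ⟨a, ha⟩ := (G.layer 1).src_surjective w
    rw [← S.rng_eq_of_mem_cell (h a ha) he, G.vert_col (n := 0) a]
    exact congrArg Sigma.fst ha.symm
  exact vertex_ext (n := 0) ((hfst w h).trans (hfst w' h').symm) fun b b' hb hb' hc =>
    S.eq_of_mem_cell (h b hb) (h' b' hb') hc

/-- A point of the shift space in the inverse image of `φ y` under the partial homeomorphism
of an edge is `φ` of the corresponding point of `Y`. -/
theorem src_col_eq_node (S : ECStructure G ρ) {φ : Y → G.Path}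
    (hφ : IsEquivariant S G.shiftStructure φ) {n : ℕ} {y : Y} {b : (G.layer (n + 2)).Edge}
    (hb : (G.layer (n + 2)).src b = (φ y).node (n + 2))
    (hy : y ∈ S.transferDom n (root (n + 2) b)) :
    (G.layer (n + 1)).src ((G.layer (n + 2)).col b) =
      (φ (S.transfer n (root (n + 2) b) y)).node (n + 1) := by
  by_cases h : G.IsBlue (n + 2) b
  · rw [← S.transfer_add_two, S.transfer_of_isBlue h, eq_of_isBlue h ((φ y).2 _).1 hb,
      G.col_path (φ y) (n + 1), Path.node]
  -- In an even layer the red edge `b` lies on the thread of the image of a preimage `t` of `y`,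
  -- chosen in the set `W f` given by the root of `b`. In an odd layer it lies on the thread of `φ
  -- y` itself.
  rcases Nat.even_or_odd' n with ⟨j, rfl | rfl⟩
  · rcases hr : root (2 * j + 2) b with e | f
    · rw [isBlue_iff_root, hr] at h
      exact absurd rfl h
    rw [hr] at hy
    have hj : Even (2 * j) := even_two_mul j
    have hy := hy.1 hj
    rw [S.transfer_inr_even hj]
    set t := S.branch f y
    have ht : G.shift (φ t) = φ y := by rw [← hφ.semiconj t, S.apply_branch hy]
    have hf : redThread (φ t) 0 = (Sum.inr f : G.B ⊕ G.R) :=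
      mem_cylRed.1 (hφ.image_W f ⟨t, S.branch_mem hy, rfl⟩)
    have hbt : b = redThread (φ t) (2 * j + 2) := by
      refine eq_redThread_of_root (x := φ t) (j + 1) b ?_ (hr.trans hf.symm)
      rw [ht]
      exact hb
    rw [hbt, col_redThread, src_redThread_odd]
  · have hj : ¬ Even (2 * j + 1 + 2) := by simp [parity_simps]
    rw [← S.transfer_add_two, S.transfer_of_odd hj h, hφ.semiconj y]
    have hbt : b = redThread (φ y) (2 * j + 3) :=
      eq_of_not_isBlue (j := j + 1) h (not_isBlue_redThread _ _)
        (hb.trans (src_redThread_odd (φ y) (j + 1)).symm)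
    rw [hbt, col_redThread]
    exact src_redThread_even (φ y) (j + 1)

/-- There is a unique equivariant map to the generalized finite shift, and it is continuous. -/
theorem exists_unique_equivariant (S : ECStructure G ρ) (hρ : IsLocalHomeomorph ρ) :
    ∃ ψ : Y → G.Path, IsEquivariant S G.shiftStructure ψ ∧ Continuous ψ ∧
      ∀ φ, IsEquivariant S G.shiftStructure φ → φ = ψ := by
  obtain ⟨p, hp, hp0, hp1, hfst, hrec⟩ := S.exists_coding
  have hex : ∀ y, ∃ x : G.Path, ∀ n, x.node n = p n y := by
    -- Blue edges act as the identity, so the blue edge at the cell of `y` in layer `n + 1` has the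
    -- cell of the same point `y` in layer `n` as its range.
    refine fun y => exists_path_of_node (fun n => p n y) fun n => ?_
    rw [← (hp n).src_col y _ (src_blueAt _ _), S.transfer_of_isBlue (isBlue_blueAt _ _)]
  choose ψ hψ using hex
  have hW : ∀ f y, y ∈ S.W f → ψ y ∈ G.cylRed f := by
    intro f y hy
    obtain ⟨f', hf'⟩ := exists_mem_cylRed (ψ y)
    have h := hp1 y (redThread (ψ y) 1) ((src_redThread_odd (ψ y) 0).trans (hψ y 1))
    rw [col_redThread, mem_cylRed.1 hf'] at h
    rwa [S.eq_of_mem_W hy h]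
  have heq : IsEquivariant S G.shiftStructure ψ := by
    refine ⟨?_, ?_, fun y => Path.ext_even fun j => ?_⟩
    · rintro e _ ⟨y, hy, rfl⟩
      exact mem_cylBlue.2 ((hψ y 0).trans (hp0 y e hy))
    · rintro f _ ⟨y, hy, rfl⟩
      exact hW f y hy
    -- The red edge of the thread in layer `2j + 1` acts by `ρ` and ends at a node of the shifted
    -- path; hence the cell of `ρ y` in layer `2j` is that node.
    · have h := (hp (2 * j)).src_col y (redThread (ψ y) (2 * j + 1))
        ((src_redThread_odd (ψ y) j).trans (hψ y _))
      rw [S.transfer_of_odd (by simp [parity_simps]) (not_isBlue_redThread _ _), col_redThread,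
        src_redThread_even] at h
      rw [hψ, h]
  refine ⟨ψ, heq, continuous_of_node fun n => ?_, fun φ hφ => funext fun y => ?_⟩
  · simp only [hψ]
    -- The recursion has order two, so the induction carries two consecutive layers.
    suffices h : ∀ n, IsLocallyConstant (p n) ∧ IsLocallyConstant (p (n + 1)) from (h n).1
    intro n
    induction n with
    | zero =>
      constructor <;> refine (IsLocallyConstant.iff_eventually_eq _).2 fun y => ?_
      · obtain ⟨e, he⟩ := S.exists_mem_Z y
        filter_upwards [(S.isOpen_Z e).mem_nhds he] with z hz
        rw [hp0 z e hz, hp0 y e he]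
      · have := (G.layer 1).finEdge
        have h : ∀ᶠ z in 𝓝 y, ∀ a, (G.layer 1).src a = p 1 y →
            z ∈ S.cell ((G.layer 1).col a) := by
          refine Filter.eventually_all.2 fun a => ?_
          by_cases ha : (G.layer 1).src a = p 1 y
          · filter_upwards [(S.isOpen_cell _).mem_nhds (hp1 y a ha)] with z hz _ using hz
          · exact Filter.Eventually.of_forall fun z h => absurd h ha
        filter_upwards [h] with z hz
        exact S.vertex_ext_cell (hp1 z) hz
    | succ n ih =>
      refine ⟨ih.2, (IsLocallyConstant.iff_eventually_eq _).2 fun y => ?_⟩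
      have := (G.layer n).finEdge
      -- Finitely many edges of layer `n` are involved, and `y` lies in the domain of each transfer
      -- that starts at its cell; so all transferred points keep their cells in layer `n + 1` near
      -- `y`.
      have h : ∀ᶠ z in 𝓝 y, ∀ x, (G.layer n).src x = p n y →
          p (n + 1) (S.transfer n (root n x) z) = p (n + 1) (S.transfer n (root n x) y) := by
        refine Filter.eventually_all.2 fun x => ?_
        by_cases hx : (G.layer n).src x = p n y
        · have := (S.continuousAt_transfer hρ ((hp n).mem_dom y x hx)).eventually
            ((IsLocallyConstant.iff_eventually_eq _).1 ih.2 _)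
          filter_upwards [this] with z hz _ using hz
        · exact Filter.Eventually.of_forall fun z h => absurd h hx
      filter_upwards [h, (IsLocallyConstant.iff_eventually_eq _).1 ih.1 y] with z hz hz0
      refine vertex_ext_src ((hfst n z).trans (hz0.trans (hfst n y).symm)) fun b b' hb hb' hc => ?_
      have hr : root (n + 2) b = root (n + 2) b' := congrArg (root n) hc
      rw [hrec n z b hb, hrec n y b' hb', hr]
      refine hz ((G.layer (n + 1)).col ((G.layer (n + 2)).col b')) ?_
      rw [src_col_col, ← hfst]
      exact congrArg Sigma.fst hb'
  -- The nodes of `φ y` agree with the coding in layers 0 and 1 because `φ` respects the structure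
  -- sets, and afterwards because both satisfy the same recursion. The inductive hypothesis is
  -- needed at the transferred points, so it is kept for all `y`.
  · suffices h : ∀ n, (∀ y, (φ y).node n = p n y) ∧ ∀ y, (φ y).node (n + 1) = p (n + 1) y from
      Path.ext_node fun n => ((h n).1 y).trans (hψ y n).symm
    intro n
    induction n with
    | zero =>
      refine ⟨fun y => ?_, fun y => ?_⟩
      · obtain ⟨e, he⟩ := S.exists_mem_Z y
        rw [hp0 y e he]
        exact mem_cylBlue.1 (hφ.image_Z e ⟨y, he, rfl⟩)
      · refine G.shiftStructure.vertex_ext_cell (y := φ y)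
          (fun a ha => mem_cell_of_src_eq_node ha) fun a ha => ?_
        have h := hp1 y a ha
        generalize (G.layer 1).col a = x at h ⊢
        rcases x with e | f
        · exact hφ.image_Z e ⟨y, h, rfl⟩
        · exact hφ.image_W f ⟨y, h, rfl⟩
    | succ n ih =>
      refine ⟨ih.2, fun y => ?_⟩
      refine vertex_ext_src (((φ y).node_add_two n).trans ((ih.1 y).trans (hfst n y).symm))
        fun b b' hb hb' hc => ?_
      have hr : root (n + 2) b = root (n + 2) b' := congrArg (root n) hc
      have hdom : y ∈ S.transferDom n (root (n + 2) b) := by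
        rw [hr]
        refine (hp n).mem_dom y ((G.layer (n + 1)).col ((G.layer (n + 2)).col b')) ?_
        rw [src_col_col, ← hfst]
        exact congrArg Sigma.fst hb'
      rw [S.src_col_eq_node hφ hb hdom, hrec n y b' hb', ← hr]
      exact ih.2 _

/-! ### Bijectivity on the fibres of the local homeomorphisms -/

/-- An equivariant map is bijective on the fibres of the local homeomorphisms. -/
theorem bijOn_fiber {X : Type w} [TopologicalSpace X] {σ : X → X} (S : ECStructure G ρ)
    (T : ECStructure G σ) {ψ : Y → X} (hψ : IsEquivariant S T ψ) (y : Y) :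
    Set.BijOn ψ {z | ρ z = y} {z | σ z = ψ y} := by
  -- The sets `W f` cover `Y` and those of the target are disjoint, so membership in them is
  -- reflected as well as preserved.
  have hW : ∀ z f, ψ z ∈ T.W f → z ∈ S.W f := by
    intro z f hz
    obtain ⟨e, he⟩ := S.exists_mem_Z z
    obtain ⟨f', -, hf'⟩ := S.exists_mem_W he
    rwa [T.eq_of_mem_W hz (hψ.image_W f' ⟨z, hf', rfl⟩)]
  refine ⟨fun z hz => ?_, fun z hz z' hz' h => ?_, fun x hx => ?_⟩
  · have hz : ρ z = y := hz
    exact (hψ.semiconj z).symm.trans (congrArg ψ hz)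
  · obtain ⟨e, he⟩ := S.exists_mem_Z z
    obtain ⟨f, -, hf⟩ := S.exists_mem_W he
    refine S.injOn f hf (hW z' f (h ▸ hψ.image_W f ⟨z, hf, rfl⟩)) (Eq.trans hz (Eq.symm hz'))
  -- A preimage `x` of `ψ y` lies in some `T.W f`. Then `y` lies in the set `S.Z e` with `s(e) =
  -- s(f)`, so it has a preimage in `S.W f`, which must be sent to `x` by injectivity of `σ` on `T.W
  -- f`.
  · have hx : σ x = ψ y := hx
    obtain ⟨e', he'⟩ := T.exists_mem_Z x
    obtain ⟨f, -, hf⟩ := T.exists_mem_W he'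
    obtain ⟨e, he⟩ := G.sB_bijective.2 (G.sR f)
    have hyT : ψ y ∈ T.Z e := by
      rw [← T.image_eq e f he]
      exact ⟨x, hf, hx⟩
    obtain ⟨e₁, he₁⟩ := S.exists_mem_Z y
    rw [← T.eq_of_mem_Z hyT (hψ.image_Z e₁ ⟨y, he₁, rfl⟩), ← S.image_eq e f he] at he₁
    obtain ⟨t, ht, hty⟩ := he₁
    refine ⟨t, hty, T.injOn f (hψ.image_W f ⟨t, ht, rfl⟩) hf ?_⟩
    rw [← hψ.semiconj t, hty, hx]

end ECStructure

/-! ### The induced map of Deaconu-Renault groupoids -/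

namespace DR

section Fiber

variable {X Y : Type*} {σ : X → X} {ρ : Y → Y} {ψ : Y → X}

theorem bijOn_iterate_fiber (hs : Function.Semiconj ψ ρ σ)
    (hb : ∀ y, Set.BijOn ψ {z | ρ z = y} {z | σ z = ψ y}) (n : ℕ) (y : Y) :
    Set.BijOn ψ {z | ρ^[n] z = y} {z | σ^[n] z = ψ y} := by
  induction n generalizing y with
  | zero =>
    refine ⟨fun z hz => congrArg ψ hz, fun z hz z' hz' _ => Eq.trans hz (Eq.symm hz'),
      fun x hx => ⟨y, rfl, Eq.symm hx⟩⟩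
  | succ n ih =>
    refine ⟨fun z hz => ?_, fun z hz z' hz' h => ?_, fun x hx => ?_⟩
    · exact ((hs.iterate_right (n + 1)) z).symm.trans (congrArg ψ hz)
    · have h1 : ρ z = ρ z' := (ih y).injOn hz hz' (by rw [hs z, hs z', h])
      exact (hb (ρ z')).injOn h1 rfl h
    · obtain ⟨t, ht, htx⟩ := (ih y).surjOn hx
      obtain ⟨s, hs, hsx⟩ := (hb t).surjOn (show σ x = ψ t from htx.symm)
      refine ⟨s, ?_, hsx⟩
      have hs : ρ s = t := hs
      change ρ^[n] (ρ s) = y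
      rw [hs]
      exact ht

theorem eq_of_iterate_eq (hs : Function.Semiconj ψ ρ σ)
    (hb : ∀ y, Set.BijOn ψ {z | ρ z = y} {z | σ z = ψ y}) {n : ℕ} {z z' : Y}
    (h : ρ^[n] z = ρ^[n] z') (h' : ψ z = ψ z') : z = z' :=
  (bijOn_iterate_fiber hs hb n _).injOn h rfl h'

/-- The point is that `ψ_*` cannot lower the exponents: an element of degree `m - n` whose image
satisfies the equation for `m` and `n` satisfies it already. Bijectivity on the fibres of iterates
is what excludes the alternative. -/
theorem map_preimage_cyl (hs : Function.Semiconj ψ ρ σ)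
    (hb : ∀ y, Set.BijOn ψ {z | ρ z = y} {z | σ z = ψ y}) (U V : Set X) (m n : ℕ) :
    map ψ hs ⁻¹' cyl σ U m n V = cyl ρ (ψ ⁻¹' U) m n (ψ ⁻¹' V) := by
  ext γ
  constructor
  · rintro ⟨h1, h2, h3, h4⟩
    refine ⟨h1, h2, h3, ?_⟩
    have h3 : γ.deg = (m : ℤ) - n := h3
    have h4 : σ^[m] (ψ γ.rng) = σ^[n] (ψ γ.src) := h4
    rw [← (hs.iterate_right m) γ.rng, ← (hs.iterate_right n) γ.src] at h4
    obtain ⟨p, q, hγ⟩ := exists_cyl γ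
    have hd := hγ.2.2.1
    rcases le_total m p with hm | hm
    -- If `γ` is only known to satisfy the equation after `t` further iterations, then `ρ^m` of its
    -- range and `ρ^n` of its source lie in one fibre of `ρ^t` and have the same image under `ψ`, so
    -- they coincide.
    · obtain ⟨t, rfl⟩ := Nat.exists_eq_add_of_le' hm
      obtain rfl : q = t + n := by omega
      have h5 := hγ.2.2.2
      rw [Function.iterate_add_apply, Function.iterate_add_apply] at h5
      exact eq_of_iterate_eq hs hb h5 h4
    · obtain ⟨t, rfl⟩ := Nat.exists_eq_add_of_le' hm
      obtain rfl : n = t + q := by omega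
      exact (cyl_le t hγ).2.2.2
  · rintro ⟨h1, h2, h3, h4⟩
    refine ⟨h1, h2, h3, ?_⟩
    change σ^[m] (ψ γ.rng) = σ^[n] (ψ γ.src)
    rw [← (hs.iterate_right m) γ.rng, ← (hs.iterate_right n) γ.src, h4]

/-- With source and degree fixed, a cylinder containing the element confines its range to a fibre of
`ρ^m`, and there `ψ` is bijective. For injectivity, `map_preimage_cyl` places both elements in the
same cylinder. -/
theorem map_bijOn (hs : Function.Semiconj ψ ρ σ)
    (hb : ∀ y, Set.BijOn ψ {z | ρ z = y} {z | σ z = ψ y}) (y : Y) :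
    Set.BijOn (map ψ hs) {γ | γ.src = y} {γ | γ.src = ψ y} := by
  refine ⟨fun γ hγ => congrArg ψ hγ, fun γ hγ δ hδ h => ?_, fun γ hγ => ?_⟩
  · have hsrc : γ.src = δ.src := Eq.trans hγ (Eq.symm hδ)
    have hdeg : γ.deg = δ.deg := congrArg (deg (σ := σ)) h
    have hrng : ψ γ.rng = ψ δ.rng := congrArg (rng (σ := σ)) h
    refine ext ?_ hdeg hsrc
    obtain ⟨m, n, -, -, h1, h2⟩ := exists_cyl γ
    have hδ : map ψ hs δ ∈ cyl σ Set.univ m n Set.univ := by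
      rw [← h, ← Set.mem_preimage, map_preimage_cyl hs hb]
      exact ⟨trivial, trivial, h1, h2⟩
    rw [← Set.mem_preimage, map_preimage_cyl hs hb] at hδ
    exact eq_of_iterate_eq hs hb (h2.trans (hsrc ▸ hδ.2.2.2.symm)) hrng
  · have hγ : γ.src = ψ y := hγ
    obtain ⟨m, n, -, -, h1, h2⟩ := exists_cyl γ
    rw [hγ, ← (hs.iterate_right n) y] at h2
    obtain ⟨x, hx, hxγ⟩ := (bijOn_iterate_fiber hs hb m _).surjOn h2
    exact ⟨⟨(x, γ.deg, y), m, n, h1, hx⟩, rfl, ext hxγ rfl hγ.symm⟩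

end Fiber

section Topology

variable {X Y : Type*} [TopologicalSpace X] [TopologicalSpace Y] {σ : X → X} {ρ : Y → Y}
  {ψ : Y → X}

/-- For fixed exponents the cylinder is the image of a closed subset of `Y × Y`. The parametrization
is continuous because cylinders with these same exponents form a neighborhood basis at each point,
by `exists_cyl_subset`. -/
theorem isCompact_cyl_univ [CompactSpace Y] [T2Space Y] (hρ : IsLocalHomeomorph ρ) (m n : ℕ) :
    IsCompact (cyl ρ Set.univ m n Set.univ) := by
  have hc := fun k => (iterate_isLocalHomeomorph hρ k).continuous
  have hD : IsClosed {p : Y × Y | ρ^[m] p.1 = ρ^[n] p.2} :=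
    isClosed_eq ((hc m).comp continuous_fst) ((hc n).comp continuous_snd)
  have := isCompact_iff_compactSpace.1 hD.isCompact
  let j : {p : Y × Y | ρ^[m] p.1 = ρ^[n] p.2} → DR ρ := fun p =>
    ⟨(p.1.1, (m : ℤ) - n, p.1.2), m, n, rfl, p.2⟩
  have hj : Continuous j := by
    refine continuous_iff_continuousAt.2 fun p => continuousAt_def.2 fun A hA => ?_
    obtain ⟨S, hSA, hS, hp⟩ := mem_nhds_iff.1 hA
    obtain ⟨U, V, hU, hV, h1, h2, hUV⟩ := exists_cyl_subset hρ (γ := j p)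
      ⟨trivial, trivial, rfl, p.2⟩ hS hp
    filter_upwards [continuous_subtype_val.continuousAt.preimage_mem_nhds
      ((hU.prod hV).mem_nhds (show p.1 ∈ U ×ˢ V from ⟨h1, h2⟩))] with q hq
    exact hSA (hUV ⟨hq.1, hq.2, rfl, q.2⟩)
  have hr : Set.range j = cyl ρ Set.univ m n Set.univ := by
    ext γ
    constructor
    · rintro ⟨p, rfl⟩
      exact ⟨trivial, trivial, rfl, p.2⟩
    · rintro ⟨-, -, h1, h2⟩
      exact ⟨⟨(γ.rng, γ.src), h2⟩, ext rfl h1.symm rfl⟩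
  rw [← hr]
  exact isCompact_range hj

theorem continuous_map (hs : Function.Semiconj ψ ρ σ)
    (hb : ∀ y, Set.BijOn ψ {z | ρ z = y} {z | σ z = ψ y}) (hψ : Continuous ψ) :
    Continuous (map ψ hs) := by
  refine continuous_generateFrom_iff.2 ?_
  rintro _ ⟨U, V, m, n, hU, hV, rfl⟩
  rw [map_preimage_cyl hs hb]
  exact isOpen_cyl m n (hU.preimage hψ) (hV.preimage hψ)

/-- A compact set is covered by finitely many full cylinders, whose preimages are full cylinders and
hence compact; the preimage of `C` is a closed subset of their union. -/
theorem isCompact_map_preimage (hs : Function.Semiconj ψ ρ σ)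
    (hb : ∀ y, Set.BijOn ψ {z | ρ z = y} {z | σ z = ψ y}) (hψ : Continuous ψ) [T2Space X]
    [CompactSpace Y] [T2Space Y] (hρ : IsLocalHomeomorph ρ) {C : Set (DR σ)} (hC : IsCompact C) :
    IsCompact (map ψ hs ⁻¹' C) := by
  have := t2Space (σ := σ)
  choose m n hmn using exists_cyl (σ := σ)
  obtain ⟨t, -, hsub⟩ := hC.elim_nhds_subcover
    (fun γ => cyl σ Set.univ (m γ) (n γ) Set.univ)
    fun γ _ => (isOpen_cyl _ _ isOpen_univ isOpen_univ).mem_nhds (hmn γ)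
  refine (t.isCompact_biUnion fun γ _ => isCompact_cyl_univ hρ (m γ) (n γ)).of_isClosed_subset
    (hC.isClosed.preimage (continuous_map hs hb hψ)) fun γ hγ => ?_
  obtain ⟨δ, hδ, h⟩ := Set.mem_iUnion₂.1 (hsub hγ)
  rw [← Set.mem_preimage, map_preimage_cyl hs hb] at h
  exact Set.mem_iUnion₂.2 ⟨δ, hδ, h⟩

end Topology

/-! ### The homomorphism of Steinberg algebras -/

section Algebra

variable {K : Type*} [Field K] {X Y : Type*} {σ : X → X} {ρ : Y → Y} {ψ : Y → X}

/-- Both sides sum the same terms over source fibres matched by `map_bijOn`. Reindexing by a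
bijection needs no finiteness, so `f` and `g` are arbitrary. -/
theorem conv_comp_map (hs : Function.Semiconj ψ ρ σ)
    (hb : ∀ y, Set.BijOn ψ {z | ρ z = y} {z | σ z = ψ y}) (f g : DR σ → K) :
    conv f g ∘ map ψ hs = conv (f ∘ map ψ hs) (g ∘ map ψ hs) := by
  funext γ
  exact (finsum_comp_equiv ((map_bijOn hs hb γ.src).equiv)).symm

/-- An element sent to a unit has the same image as the unit at its own source, so injectivity on
source fibres makes it a unit. -/
theorem one_comp_map (hs : Function.Semiconj ψ ρ σ)
    (hb : ∀ y, Set.BijOn ψ {z | ρ z = y} {z | σ z = ψ y}) :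
    one K σ ∘ map ψ hs = one K ρ := by
  have h : map ψ hs ⁻¹' Set.range (unit σ) = Set.range (unit ρ) := by
    ext γ
    constructor
    · intro h
      obtain ⟨h1, h2⟩ := mem_range_unit.1 h
      refine ⟨γ.src, (map_bijOn hs hb γ.src).injOn (x₁ := unit ρ γ.src) (x₂ := γ) rfl rfl ?_⟩
      exact ext h1.symm (Eq.symm h2) rfl
    · rintro ⟨y, rfl⟩
      exact ⟨ψ y, rfl⟩
  rw [one, one, ← h]
  rfl

end Algebra

end DR

/-- The `*`-homomorphism induced by a map that is bijective on the fibres. -/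
theorem Steinberg.exists_starAlgHom (K : Type*) [Field K] [StarRing K] {X Y : Type*}
    [TopologicalSpace X] [TopologicalSpace Y] {σ : X → X} {ρ : Y → Y} {ψ : Y → X}
    (hσ : IsLHomeo σ) (hρ : IsLHomeo ρ) (hs : Function.Semiconj ψ ρ σ)
    (hb : ∀ y, Set.BijOn ψ {z | ρ z = y} {z | σ z = ψ y}) (hψ : Continuous ψ) :
    ∃ Φ : Steinberg K hσ →⋆ₐ[K] Steinberg K hρ,
      ∀ (f : Steinberg K hσ) (γ : DR ρ), Φ f γ = f (DR.map ψ hs γ) := by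
  have := hσ.metrizableSpace
  have := hρ.metrizableSpace
  have := hρ.compactSpace
  have := DR.t2Space (σ := ρ)
  -- Properness of the groupoid map keeps the support compact, and its continuity keeps the function
  -- locally constant.
  have hmem : ∀ f : Steinberg K hσ, f.1 ∘ DR.map ψ hs ∈ steinbergSubmodule K ρ := fun f =>
    ⟨f.2.1.comp_continuous (DR.continuous_map hs hb hψ), HasCompactSupport.intro
      (DR.isCompact_map_preimage hs hb hψ hρ.isLocalHomeomorph (DR.isCompact_support f.2))
      fun γ hγ => Function.notMem_support.1 hγ⟩
  refine ⟨{ toFun := fun f => ⟨f.1 ∘ DR.map ψ hs, hmem f⟩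
            map_one' := Subtype.ext (DR.one_comp_map hs hb)
            map_mul' := fun f g => Subtype.ext (DR.conv_comp_map hs hb f.1 g.1)
            map_zero' := rfl
            map_add' := fun f g => rfl
            commutes' := fun c => Subtype.ext ?_
            map_star' := fun f => rfl }, fun f γ => rfl⟩
  rw [Algebra.algebraMap_eq_smul_one, Algebra.algebraMap_eq_smul_one]
  exact congrArg (c • ·) (DR.one_comp_map (K := K) hs hb)

theorem theorem6p19 (K : Type w) [Field K] [StarRing K] (G : GFSGraph.{u}) {Y : Type v}
    [TopologicalSpace Y] {ρ : Y → Y} (hρ : IsLHomeo ρ) (S : ECStructure G ρ) :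
    -- the generalized finite shift and its natural `(E, C)`-structure
    ∃ (hσ : IsLHomeo G.shift) (T : ECStructure G G.shift), T.Z = G.cylBlue ∧ T.W = G.cylRed ∧
      -- the unique continuous equivariant map
      ∃ (ψ : Y → G.Path) (hψ : IsEquivariant S T ψ), Continuous ψ ∧
        (∀ φ : Y → G.Path, Continuous φ → IsEquivariant S T φ → φ = ψ) ∧
        -- the induced map of groupoids is a continuous homomorphism
        Continuous (DR.map ψ hψ.semiconj) ∧
        (∀ (γ δ : DR ρ) (h : γ.src = δ.rng),
          DR.map ψ hψ.semiconj (γ.mul δ h) =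
            (DR.map ψ hψ.semiconj γ).mul (DR.map ψ hψ.semiconj δ) (congrArg ψ h)) ∧
        -- it is proper and bijective on source fibres
        (∀ C : Set (DR G.shift), IsCompact C → IsCompact (DR.map ψ hψ.semiconj ⁻¹' C)) ∧
        (∀ y : Y, Set.BijOn (DR.map ψ hψ.semiconj) {γ | γ.src = y} {γ | γ.src = ψ y}) ∧
        -- composition with it is a `*`-homomorphism of `K`-algebras
        ∃ Φ : Steinberg K hσ →⋆ₐ[K] Steinberg K hρ,
          ∀ (f : Steinberg K hσ) (γ : DR ρ), Φ f γ = f (DR.map ψ hψ.semiconj γ) := by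
  obtain ⟨ψ, hψ, hc, huniq⟩ := S.exists_unique_equivariant hρ.isLocalHomeomorph
  have hσ := G.isLHomeo_shift
  have := hσ.metrizableSpace
  have := hρ.metrizableSpace
  have := hρ.compactSpace
  have hb := S.bijOn_fiber G.shiftStructure hψ
  exact ⟨hσ, G.shiftStructure, rfl, rfl, ψ, hψ, hc, fun φ _ hφ => huniq φ hφ,
    DR.continuous_map _ hb hc, fun _ _ _ => rfl,
    fun C hC => DR.isCompact_map_preimage _ hb hc hρ.isLocalHomeomorph hC,
    DR.map_bijOn _ hb, Steinberg.exists_starAlgHom K hσ hρ hψ.semiconj hb hc⟩
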